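/- Let $\beta>0$, let $\mathbb C_+=\{z\in\mathbb C:\operatorname{Re}z>0\}$, let $(g_k)_{k\in\mathbb N}$ be a sequence of nonzero complex numbers, and let $(z_k)_{k\in\mathbb N}$ be a Blaschke sequence in $\mathbb C_+$, i.e. $\operatorname{Re}z_k>0$ for all $k$ and $\sum_k \frac{\operatorname{Re}z_k}{1+|z_k|^2}<\infty$. Write $$p(z,w)=\left|\frac{z-w}{z+\overline w}\right|,\qquad b_{\infty,k}=\prod_{j\ne k}p(z_j,z_k),\qquad \mathcal L f(z)=\int_0^\infty e^{-tz}f(t)\,dt .$$ Let $\mathcal H^2_\beta=\mathcal H^2_\beta(0,\infty)$ be the space of all $f\in L^2(0,\infty)$ whose fractional derivative $\left(\frac{d}{dt}\right)^\beta f$ lies in $L^2$. Here $\left(\frac{d}{dt}\right)^\beta f$ is defined through the Fourier transform: $f$ is extended by zero to $\mathbb R$, and $\left(\frac{d}{dt}\right)^\beta f$ is the function in $L^2(\mathbb R)$ whose Fourier transform is $(i\omega)^\beta\hat f(\omega)$ (principal power), $\omega$ denoting angular frequency. The norm is $$\|f\|_{\mathcal H^2_\beta}^2=\int_0^\infty|f(t)|^2\,dt+\int_0^\infty\left|\left(\tfrac{d}{dt}\right)^\beta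 f(t)\right|^2dt .$$ Let $$m_\beta=\sup_{(a_k)\in\ell^2,\ \|(a_k)\|_2=1}\ \inf\left\{\|f\|_{\mathcal H^2_\beta}:\ f\in\mathcal H^2_\beta,\ g_k\,\mathcal L f(z_k)=a_k\ \text{for all }k\right\}\in[0,\infty],$$ with $\inf\emptyset=\infty$. For an interval $I\subset i\mathbb R$ of length $|I|$ let $Q_I=\{x+iy\in\mathbb C_+: iy\in I,\ 0<x<|I|\}$ be the Carleson square over $I$. Then $m_\beta<\infty$ if and only if there is a constant $\kappa>0$ such that $$\sum_{k:\,z_k\in Q_I}\frac{|2\operatorname{Re}z_k|^2\,|1+z_k|^{2\beta}}{|b_{\infty,k}|^2\,|g_k|^2}\le\kappa|I|\qquad\text{for all intervals }I\subset i\mathbb R,$$ where a term with $b_{\infty,k}=0$ is read as $\infty$. -/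

import Mathlib

open MeasureTheory Set
open scoped ENNReal NNReal FourierTransform ComplexConjugate

noncomputable section

/-- The complex Hilbert space `L²(0,∞)`. -/
abbrev L2Half : Type := Lp ℂ 2 (volume.restrict (Ioi (0 : ℝ)))

/-- Extension of a function in `L²(0,∞)` by zero to a function in `L²(ℝ)`. -/
def zeroExtend (f : L2Half) : Lp ℂ 2 (volume : Measure ℝ) :=
  ((memLp_indicator_iff_restrict measurableSet_Ioi).2 (Lp.memLp f)).toLp ((Ioi (0 : ℝ)).indicator f)

/-- The function `(2πiξ)^β f̂(ξ)`, where `f̂(ξ) = ∫ f(t) e^{-2πitξ} dt` is the `L²` Fourier transform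
of the zero extension of `f` and the power is the principal one. It is the Fourier transform of
`(d/dx)^β f`. -/
def fracDerivSymbol (β : ℝ) (f : L2Half) (ξ : ℝ) : ℂ :=
  (2 * (Real.pi : ℂ) * Complex.I * (ξ : ℂ)) ^ (β : ℂ) *
    (𝓕 (zeroExtend f) : Lp ℂ 2 (volume : Measure ℝ)) ξ

/-- The Sobolev space `ℋ²_β(0,∞)`: those `f ∈ L²(0,∞)` whose fractional derivative `(d/dx)^β f`,
defined through the Fourier transform, is square integrable. -/
def SobolevHalf (β : ℝ) : Type :=
  {f : L2Half // MemLp (fracDerivSymbol β f) 2 (volume : Measure ℝ)}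

/-- The fractional derivative `(d/dx)^β f` of `f ∈ ℋ²_β(0,∞)`. -/
def fracDeriv {β : ℝ} (f : SobolevHalf β) : Lp ℂ 2 (volume : Measure ℝ) :=
  𝓕⁻ (f.2.toLp (fracDerivSymbol β f.1))

/-- The norm `(∫₀^∞ |f|² + ∫₀^∞ |(d/dx)^β f|²)^{1/2}` of `ℋ²_β(0,∞)`. -/
def sobolevNorm {β : ℝ} (f : SobolevHalf β) : ℝ :=
  Real.sqrt ((∫ t in Ioi (0 : ℝ), ‖f.1 t‖ ^ 2) + ∫ t in Ioi (0 : ℝ), ‖fracDeriv f t‖ ^ 2)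

/-- The Laplace transform `𝓛 f(z) = ∫₀^∞ e^{-tz} f(t) dt`. -/
def laplaceTransform (f : L2Half) (z : ℂ) : ℂ :=
  ∫ t in Ioi (0 : ℝ), Complex.exp (-(t : ℂ) * z) * f t

/-- Blaschke sequences in the open right half plane. -/
def IsBlaschkeSequence (z : ℕ → ℂ) : Prop :=
  (∀ k, 0 < (z k).re) ∧ Summable fun k => (z k).re / (1 + ‖z k‖ ^ 2)

/-- The pseudo-hyperbolic metric of the right half plane. -/
def pseudoHyp (z w : ℂ) : ℝ := ‖(z - w) / (z + conj w)‖

/-- `b_{∞,k} = ∏_{j ≠ k} p(z_j, z_k)`. All factors lie in `[0,1)`, so the product converges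
(possibly to `0`). -/
def blaschkeB (z : ℕ → ℂ) (k : ℕ) : ℝ := ∏' j : {j : ℕ // j ≠ k}, pseudoHyp (z j) (z k)

/-- The constant `m_β ∈ [0,∞]`, an infimum over the empty set being `∞`. -/
def interpConst (β : ℝ) (g z : ℕ → ℂ) : ℝ≥0∞ :=
  ⨆ (a : lp (fun _ : ℕ => ℂ) 2) (_ : ‖a‖ = 1),
    ⨅ (f : SobolevHalf β) (_ : ∀ k, g k * laplaceTransform f.1 (z k) = a k),
      ENNReal.ofReal (sobolevNorm f)

/-- The Carleson square `{x + iy : iy ∈ iI, 0 < x < |I|}` over the interval `iI` of the imaginary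
axis; `|I|` is the length of `I`. -/
def carlesonSquare (I : Set ℝ) : Set ℂ :=
  {z | z.im ∈ I ∧ 0 < z.re ∧ ENNReal.ofReal z.re < volume I}

/-- The weight `|2 Re z_k|² |1 + z_k|^{2β} / (|b_{∞,k}|² |g_k|²) ∈ [0,∞]`, which is `∞` when
`b_{∞,k} = 0`. -/
def carlesonWeight (β : ℝ) (g z : ℕ → ℂ) (k : ℕ) : ℝ≥0∞ :=
  ENNReal.ofReal (|2 * (z k).re| ^ 2 * ‖1 + z k‖ ^ (2 * β)) /
    ENNReal.ofReal (|blaschkeB z k| ^ 2 * ‖g k‖ ^ 2)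

end

/-! On the Laplace side, `ℋ²_β` is `(1 + z)^{-β}` times the image of `L²(0,∞)`, with equivalent
norms. Hence interpolation with weights `g_k` in `ℋ²_β` is the same, up to constants, as
interpolation in `L²(0,∞)` with weights `G_k = g_k (1 + z_k)^{-β}`. This rests on two facts. By the
Gamma integral, the multiplier `(δ + iω)^{-s}` is an average of translations in one direction, so it
preserves causality and multiplies the Laplace transform by `(δ + z)^{-s}`. Conversely, positive
powers keep causality whenever the result is square integrable (`isCausal_of_fourier_eq_cpow_mul`,
`isCausal_fracDeriv`).

In `L²(0,∞)` the value at `z_k` is the inner product with a kernel `e_k`, and the Gram matrix of the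
kernels is a Cauchy matrix with an explicit inverse. So the minimal interpolant of `w` at finitely
many points has exactly the norm of `∑ conj(2 Re z_j w_j / B_j) e_j`, with `B_j` the finite Blaschke
product without its factor at `z_j` (`exists_interpolant_mem_span`). By duality, a bound for `w = a
/ G` uniform over the unit ball of `ℓ²` is a bound for the embedding `f ↦ (r_j 𝓛 f(z_j))` into `ℓ²`,
where `r_j = 2 Re z_j / (|G_j| |B_j|)`; that is, the masses `r_j²` at `z_j` form a Carleson measure.

For sufficiency, `carleson_embedding` bounds the finite problems, since `|B_j| ≥ b_{∞,j}`, and weak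
compactness gives the infinite one. The embedding comes from dominating `𝓛 f` by Poisson averages of
`|f̂|`, hence by dyadic averages, to which a Bellman function argument applies. For necessity, the
finite embeddings are tested on one kernel adapted to the square, and the finite products then
decrease to `b_{∞,k}`. -/

noncomputable section

/-! ### Finite interpolation and the Cauchy matrix -/

section FiniteInterpolation

variable {ι : Type*} [DecidableEq ι]

/-- The value at `z l` of the finite Blaschke product with zeros `z k`, `k ∈ s`, `k ≠ l`. -/
def finiteBlaschke (s : Finset ι) (z : ι → ℂ) (l : ι) : ℂ :=
  ∏ k ∈ s.erase l, (z l - z k) / (z l + conj (z k))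

lemma add_conj_ne_zero_of_re_pos {z w : ℂ} (hz : 0 < z.re) (hw : 0 < w.re) : z + conj w ≠ 0 := by
  intro h
  have := congrArg Complex.re h
  simp at this
  linarith

lemma finiteBlaschke_ne_zero {s : Finset ι} {z : ι → ℂ} (hz : ∀ k, 0 < (z k).re)
    (hinj : Set.InjOn z s) {l : ι} (hl : l ∈ s) : finiteBlaschke s z l ≠ 0 := by
  refine Finset.prod_ne_zero_iff.2 fun k hk => div_ne_zero ?_ (add_conj_ne_zero_of_re_pos (hz _) (hz _))
  rw [Finset.mem_erase] at hk
  exact sub_ne_zero.2 fun h => hk.1 (hinj hk.2 hl h.symm)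

lemma norm_finiteBlaschke (s : Finset ι) (z : ι → ℂ) (l : ι) :
    ‖finiteBlaschke s z l‖ = ∏ k ∈ s.erase l, pseudoHyp (z k) (z l) := by
  rw [finiteBlaschke, norm_prod]
  refine Finset.prod_congr rfl fun k _ => ?_
  rw [pseudoHyp, norm_div, norm_div, norm_sub_rev]
  congr 1
  rw [← Complex.norm_conj]
  simp [add_comm]

/-- The coefficient `2 Re z_l / conj B_l` in terms of nodal weights. -/
lemma two_re_div_conj_finiteBlaschke {s : Finset ι} {z : ι → ℂ} {l : ι} (hl : l ∈ s) :
    (2 * (z l).re : ℂ) / conj (finiteBlaschke s z l) =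
      Lagrange.nodalWeight s (fun k => conj (z k)) l * ∏ k ∈ s, (conj (z l) + z k) := by
  rw [← Finset.mul_prod_erase s _ hl, finiteBlaschke, map_prod, Lagrange.nodalWeight,
    div_eq_mul_inv, ← Finset.prod_inv_distrib, mul_left_comm, ← Finset.prod_mul_distrib]
  congr 1
  · rw [add_comm, Complex.add_conj]; push_cast; rfl
  · refine Finset.prod_congr rfl fun k _ => ?_
    simp [div_eq_mul_inv]
    ring

/-- The inverse of the Cauchy matrix `1 / (z i + conj (z l))`. -/
theorem cauchy_matrix_inverse {s : Finset ι} {z : ι → ℂ} (hz : ∀ k, 0 < (z k).re)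
    (hinj : Set.InjOn z s) {i j : ι} (hi : i ∈ s) (hj : j ∈ s) :
    ∑ l ∈ s, 1 / (z i + conj (z l)) * ((2 * (z l).re : ℂ) / conj (finiteBlaschke s z l)) *
        (1 / (conj (z l) + z j)) =
      if i = j then finiteBlaschke s z i / (2 * (z i).re : ℂ) else 0 := by
  set v : ι → ℂ := fun k => conj (z k) with hv
  -- `∏_{k ≠ j} (X + z_k)` has degree below the number of nodes `conj z_k`, so Lagrange
  -- interpolation reproduces it. Its barycentric expansion at `-z_i` is, up to sign and the nodal
  -- factor, the sum in the statement, and its value there vanishes unless `i = j`.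
  set Q : Polynomial ℂ := Lagrange.nodal (s.erase j) (fun k => -z k) with hQ
  have hvs : Set.InjOn v s := fun a ha b hb h => hinj ha hb (star_injective h)
  have hdeg : Q.degree < s.card := by
    rw [hQ, Lagrange.degree_nodal, Finset.card_erase_of_mem hj]
    exact_mod_cast Nat.sub_lt (Finset.card_pos.2 ⟨j, hj⟩) one_pos
  have hx : ∀ k ∈ s, -z i ≠ v k := by
    intro k _ h
    apply add_conj_ne_zero_of_re_pos (hz i) (hz k)
    rw [← show v k = conj (z k) from rfl, ← h]; ring
  have key : Polynomial.eval (-z i) Q = Polynomial.eval (-z i) (Lagrange.nodal s v) *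
      ∑ l ∈ s, Lagrange.nodalWeight s v l * (-z i - v l)⁻¹ * Polynomial.eval (v l) Q := by
    rw [← Lagrange.eval_interpolate_not_at_node _ hx, ← Lagrange.eq_interpolate hvs hdeg]
  have hnod : Polynomial.eval (-z i) (Lagrange.nodal s v) ≠ 0 := by
    rw [Lagrange.eval_nodal]
    exact Finset.prod_ne_zero_iff.2 fun k hk => sub_ne_zero.2 (hx k hk)
  have hsum : ∑ l ∈ s, 1 / (z i + conj (z l)) *
      ((2 * (z l).re : ℂ) / conj (finiteBlaschke s z l)) * (1 / (conj (z l) + z j)) =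
      -∑ l ∈ s, Lagrange.nodalWeight s v l * (-z i - v l)⁻¹ * Polynomial.eval (v l) Q := by
    rw [← Finset.sum_neg_distrib]
    refine Finset.sum_congr rfl fun l hl => ?_
    rw [two_re_div_conj_finiteBlaschke hl, hQ, Lagrange.eval_nodal,
      ← Finset.mul_prod_erase s _ hj]
    have h1 : conj (z l) + z j ≠ 0 := by
      rw [add_comm]; exact add_conj_ne_zero_of_re_pos (hz j) (hz l)
    have h2 : z i + conj (z l) ≠ 0 := add_conj_ne_zero_of_re_pos (hz i) (hz l)
    have h3 : (-z i - v l)⁻¹ = -(z i + conj (z l))⁻¹ := by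
      rw [← inv_neg]; congr 1; simp [hv]; ring
    rw [h3]
    simp only [sub_neg_eq_add, hv]
    field_simp
  rw [hsum, ← mul_right_inj' hnod, mul_neg, ← key]
  split_ifs with hij
  · subst hij
    rw [hQ, Lagrange.eval_nodal, Lagrange.eval_nodal, ← Finset.mul_prod_erase s _ hi,
      finiteBlaschke]
    have h0 : (2 * (z i).re : ℂ) = z i + conj (z i) := by rw [Complex.add_conj]; push_cast; rfl
    have h2 : z i + conj (z i) ≠ 0 := add_conj_ne_zero_of_re_pos (hz i) (hz i)
    have h4 : -z i - v i = -(z i + conj (z i)) := by simp [hv]; ring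
    rw [h0, h4]
    have : ∏ k ∈ s.erase i, (-z i - -z k) = (∏ k ∈ s.erase i, (-z i - v k)) *
        ∏ k ∈ s.erase i, (z i - z k) / (z i + conj (z k)) := by
      rw [← Finset.prod_mul_distrib]
      refine Finset.prod_congr rfl fun k _ => ?_
      have h5 := add_conj_ne_zero_of_re_pos (hz i) (hz k)
      simp only [hv]
      field_simp
      ring
    rw [this]
    field_simp
  · rw [hQ, Lagrange.eval_nodal, mul_zero, neg_eq_zero]
    exact Finset.prod_eq_zero (Finset.mem_erase.2 ⟨hij, hi⟩) (by simp)

variable {H : Type*} [NormedAddCommGroup H] [InnerProductSpace ℂ H]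

/-- The interpolant in the span of the kernels has the norm of an explicit combination of them. -/
theorem exists_interpolant_mem_span {s : Finset ι} {z : ι → ℂ} {e : ι → H}
    (hz : ∀ k, 0 < (z k).re) (hinj : Set.InjOn z s)
    (he : ∀ i j, inner ℂ (e i) (e j) = 1 / (z i + conj (z j))) (w : ι → ℂ) :
    ∃ F ∈ Submodule.span ℂ (e '' s), (∀ i ∈ s, inner ℂ (e i) F = w i) ∧
      ‖F‖ = ‖∑ j ∈ s, conj (2 * (z j).re * w j / finiteBlaschke s z j) • e j‖ := by
  -- The coefficients `u` are the inverse Gram matrix applied to `w`; the factor in `c` cancels the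
  -- diagonal left by `cauchy_matrix_inverse`.
  set c : ι → ℂ := fun j => 2 * (z j).re * w j / finiteBlaschke s z j with hc
  set u : ι → ℂ := fun l => (2 * (z l).re : ℂ) / conj (finiteBlaschke s z l) *
    ∑ j ∈ s, c j * (1 / (conj (z l) + z j)) with hu
  set F : H := ∑ l ∈ s, u l • e l with hF
  have hint : ∀ i ∈ s, inner ℂ (e i) F = w i := by
    intro i hi
    have : inner ℂ (e i) F = ∑ j ∈ s, c j * ∑ l ∈ s, 1 / (z i + conj (z l)) *
        ((2 * (z l).re : ℂ) / conj (finiteBlaschke s z l)) * (1 / (conj (z l) + z j)) := by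
      simp_rw [hF, inner_sum, inner_smul_right, he, hu, Finset.mul_sum, Finset.sum_mul]
      rw [Finset.sum_comm]
      refine Finset.sum_congr rfl fun _ _ => Finset.sum_congr rfl fun _ _ => ?_
      ring
    rw [this, Finset.sum_congr rfl fun j hj => by rw [cauchy_matrix_inverse hz hinj hi hj]]
    have hB := finiteBlaschke_ne_zero hz hinj hi
    have hr : ((z i).re : ℂ) ≠ 0 := by exact_mod_cast (hz i).ne'
    simp only [mul_ite, mul_zero, Finset.sum_ite_eq, hi, if_true, hc]
    field_simp
  refine ⟨F, Submodule.sum_mem _ fun l hl => Submodule.smul_mem _ _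
    (Submodule.subset_span ⟨l, hl, rfl⟩), hint, ?_⟩
  -- `⟨F, F⟩ = ∑ conj(u_l) w_l` because `F` interpolates. Inserting `u` turns this into the Gram
  -- form with coefficients `conj c`.
  have h1 : inner ℂ F F = inner ℂ (∑ j ∈ s, conj (c j) • e j) (∑ j ∈ s, conj (c j) • e j) := by
    have h2 : inner ℂ F F = ∑ l ∈ s, conj (u l) * w l := by
      conv_lhs => rw [hF, sum_inner]
      refine Finset.sum_congr rfl fun l hl => ?_
      rw [inner_smul_left, hint l hl]
    rw [h2, sum_inner]
    refine Finset.sum_congr rfl fun l hl => ?_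
    simp_rw [inner_smul_left, inner_sum, inner_smul_right, he, hu, hc]
    simp only [map_mul, map_div₀, map_sum, Complex.conj_conj, Complex.conj_ofReal, map_add, map_one,
      map_ofNat, Finset.mul_sum, Finset.sum_mul]
    refine Finset.sum_congr rfl fun j _ => ?_
    ring
  have h3 := congrArg Complex.re h1
  have h4 : ∀ x : H, (inner ℂ x x).re = ‖x‖ ^ 2 := fun x => by
    rw [inner_self_eq_norm_sq_to_K]; norm_cast
  rw [h4, h4] at h3
  exact (sq_eq_sq₀ (norm_nonneg _) (norm_nonneg _)).1 h3

end FiniteInterpolation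

/-! ### Minimal norm and weak compactness -/

/-- Among all elements with prescribed inner products against `e i`, `i ∈ s`, the one in their span
has the least norm. -/
lemma norm_le_of_mem_span_of_inner_eq {ι H : Type*} [NormedAddCommGroup H] [InnerProductSpace ℂ H]
    {e : ι → H} {s : Set ι} {F h : H}
    (hF : F ∈ Submodule.span ℂ (e '' s)) (hh : ∀ i ∈ s, inner ℂ (e i) h = inner ℂ (e i) F) :
    ‖F‖ ≤ ‖h‖ := by
  have horth : ∀ x ∈ Submodule.span ℂ (e '' s), inner ℂ x (h - F) = 0 := by
    intro x hx
    induction hx using Submodule.span_induction with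
    | mem x hx => obtain ⟨i, hi, rfl⟩ := hx; rw [inner_sub_right, hh i hi, sub_self]
    | zero => simp
    | add x y _ _ h1 h2 => rw [inner_add_left, h1, h2, add_zero]
    | smul a x _ h1 => rw [inner_smul_left, h1, mul_zero]
  have h1 : inner ℂ F h = inner ℂ F F := by
    have := horth F hF
    rwa [inner_sub_right, sub_eq_zero] at this
  by_contra! hlt
  have h2 : ‖F‖ ^ 2 ≤ ‖F‖ * ‖h‖ := by
    calc ‖F‖ ^ 2 = ‖inner ℂ F h‖ := by rw [h1, inner_self_eq_norm_sq_to_K]; simp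
      _ ≤ _ := norm_inner_le_norm _ _
  nlinarith [norm_nonneg h]

/-- Weak compactness: countably many linear constraints can be met in a ball as soon as finitely many
of them always can. -/
theorem exists_forall_inner_eq_of_forall_lt {H : Type*} [NormedAddCommGroup H]
    [InnerProductSpace ℂ H] [CompleteSpace H] (e : ℕ → H) (w : ℕ → ℂ) (M : ℝ)
    (h : ∀ n, ∃ F : H, ‖F‖ ≤ M ∧ ∀ k < n, inner ℂ (e k) F = w k) :
    ∃ F : H, ‖F‖ ≤ M ∧ ∀ k, inner ℂ (e k) F = w k := by
  -- Through the Riesz map the ball is weak-* compact, and each constraint is closed, being an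
  -- evaluation at `e k`. The values are conjugated because the Riesz map is antilinear. The nested
  -- nonempty sets `S n` then have a common point.
  let B : Set (WeakDual ℂ H) := WeakDual.toStrongDual ⁻¹' Metric.closedBall 0 M
  have hB : IsCompact B := WeakDual.isCompact_closedBall 0 M
  let S : ℕ → Set (WeakDual ℂ H) := fun n => B ∩ ⋂ k ∈ Set.Iio n, {φ | φ (e k) = conj (w k)}
  have hcl : ∀ n, IsClosed (⋂ k ∈ Set.Iio n, {φ : WeakDual ℂ H | φ (e k) = conj (w k)}) := fun n =>
    isClosed_biInter fun k _ => isClosed_eq (WeakDual.eval_continuous _) continuous_const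
  have hne : (⋂ n, S n).Nonempty := by
    refine IsCompact.nonempty_iInter_of_sequence_nonempty_isCompact_isClosed S ?_ ?_ ?_ ?_
    · intro n φ hφ
      refine ⟨hφ.1, ?_⟩
      have := hφ.2
      simp only [mem_iInter, mem_Iio] at this ⊢
      exact fun k hk => this k (by omega)
    · intro n
      obtain ⟨F, hF, hk⟩ := h n
      refine ⟨StrongDual.toWeakDual (InnerProductSpace.toDual ℂ H F), ?_, ?_⟩
      · simpa [B] using hF
      · simp only [mem_iInter, mem_Iio]
        intro k hkn
        change inner ℂ F (e k) = _
        rw [← hk k hkn, inner_conj_symm]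
    · exact hB.inter_right (hcl 0)
    · exact fun n => hB.isClosed.inter (hcl n)
  obtain ⟨φ, hφ⟩ := hne
  rw [mem_iInter] at hφ
  refine ⟨(InnerProductSpace.toDual ℂ H).symm (WeakDual.toStrongDual φ), ?_, fun k => ?_⟩
  · simpa [B] using (hφ 0).1
  · have := (hφ (k + 1)).2
    simp only [mem_iInter, mem_Iio] at this
    have h2 := this k (Nat.lt_succ_self k)
    rw [← inner_conj_symm, InnerProductSpace.toDual_symm_apply]
    change conj (φ (e k)) = _
    rw [h2, Complex.conj_conj]

/-! ### The dyadic Carleson embedding -/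

section Dyadic

variable {ι : Type*}

/-- The Bellman function inequality behind the dyadic Carleson embedding. -/
lemma bellman_step {κ L α S₀ S₁ q₀ q₁ : ℝ} (hκ : 0 < κ) (hL : 0 < L) (hα : 0 ≤ α) (h₀ : 0 ≤ S₀)
    (h₁ : 0 ≤ S₁) (hS : α + S₀ + S₁ ≤ κ * (2 * L)) :
    α * ((q₀ + q₁) / (2 * L)) ^ 2 + 4 * κ * (κ * (q₀ + q₁) ^ 2 / (κ * (2 * L) + (α + S₀ + S₁))) ≤
      4 * κ * (κ * q₀ ^ 2 / (κ * L + S₀) + κ * q₁ ^ 2 / (κ * L + S₁)) := by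
  have hκL : 0 < κ * L := mul_pos hκ hL
  set a := κ * L + S₀ with ha
  set b := κ * L + S₁ with hb
  have ha0 : 0 < a := by positivity
  have hb0 : 0 < b := by positivity
  have e1 : κ * (2 * L) + (α + S₀ + S₁) = a + b + α := by rw [ha, hb]; ring
  have hab : a + b + α ≤ 4 * (κ * L) := by rw [← e1]; linarith
  rw [e1]
  -- Subadditivity of `(q, a) ↦ q² / a` handles the two halves.
  have h2 : (q₀ + q₁) ^ 2 / (a + b) ≤ q₀ ^ 2 / a + q₁ ^ 2 / b := by
    rw [div_add_div _ _ ha0.ne' hb0.ne', div_le_div_iff₀ (by positivity) (by positivity)]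
    nlinarith [sq_nonneg (q₀ * b - q₁ * a)]
  -- The gain from the mass `α`: the difference is `α / ((a + b)(a + b + α))`, and the Carleson
  -- bound keeps both factors below `4κL`. This is the source of the constant `4κ`.
  have h3 : α / (4 * (κ * L)) ^ 2 ≤ 1 / (a + b) - 1 / (a + b + α) := by
    rw [div_sub_div _ _ (by positivity) (by positivity)]
    have : 1 * (a + b + α) - (a + b) * 1 = α := by ring
    rw [this]
    refine div_le_div_of_nonneg_left hα (by positivity) ?_
    nlinarith
  have h4 : α * ((q₀ + q₁) / (2 * L)) ^ 2 = 4 * κ * (κ * ((q₀ + q₁) ^ 2 * (α / (4 * (κ * L)) ^ 2))) := by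
    field_simp; norm_num
  rw [h4]
  have h5 := mul_le_mul_of_nonneg_left h3 (sq_nonneg (q₀ + q₁))
  have h6 : κ * ((q₀ + q₁) ^ 2 * (α / (4 * (κ * L)) ^ 2)) + κ * (q₀ + q₁) ^ 2 / (a + b + α) ≤
      κ * q₀ ^ 2 / a + κ * q₁ ^ 2 / b := by
    have : κ * ((q₀ + q₁) ^ 2 * (α / (4 * (κ * L)) ^ 2) + (q₀ + q₁) ^ 2 / (a + b + α)) ≤
      κ * (q₀ ^ 2 / a + q₁ ^ 2 / b) := by
      refine mul_le_mul_of_nonneg_left ?_ hκ.le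
      calc _ ≤ (q₀ + q₁) ^ 2 * (1 / (a + b) - 1 / (a + b + α)) + (q₀ + q₁) ^ 2 / (a + b + α) := by
            gcongr
        _ = (q₀ + q₁) ^ 2 / (a + b) := by ring
        _ ≤ _ := h2
    calc _ = κ * ((q₀ + q₁) ^ 2 * (α / (4 * (κ * L)) ^ 2) + (q₀ + q₁) ^ 2 / (a + b + α)) := by ring
      _ ≤ _ := this
      _ = _ := by ring
  nlinarith

lemma floor_div_zpow_succ (p : ℝ) (j : ℤ) : ⌊p / 2 ^ (j + 1)⌋ = ⌊p / 2 ^ j⌋ / 2 := by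
  have : p / 2 ^ (j + 1) = p / 2 ^ j / (2 : ℕ) := by
    rw [zpow_add_one₀ two_ne_zero, Nat.cast_ofNat, div_div]
  rw [this, Int.floor_div_natCast]; rfl

/-- The elements of `K` whose dyadic interval (level `l k`, containing `p k`) lies in the dyadic
interval `[i 2^j, (i+1) 2^j)`. -/
def dyadicBelow (K : Finset ι) (l : ι → ℤ) (p : ι → ℝ) (j i : ℤ) : Finset ι :=
  K.filter fun k => l k ≤ j ∧ ⌊p k / 2 ^ j⌋ = i

lemma sum_dyadicBelow_succ (K : Finset ι) (l : ι → ℤ) (p : ι → ℝ) (j i : ℤ) (f : ι → ℝ) :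
    ∑ k ∈ dyadicBelow K l p (j + 1) i, f k =
      ∑ k ∈ K.filter (fun k => l k = j + 1 ∧ ⌊p k / 2 ^ (j + 1)⌋ = i), f k +
        ∑ k ∈ dyadicBelow K l p j (2 * i), f k + ∑ k ∈ dyadicBelow K l p j (2 * i + 1), f k := by
  classical
  simp only [dyadicBelow, Finset.sum_filter]
  rw [← Finset.sum_add_distrib, ← Finset.sum_add_distrib]
  refine Finset.sum_congr rfl fun k _ => ?_
  rw [floor_div_zpow_succ]
  generalize ⌊p k / 2 ^ j⌋ = n
  split_ifs <;> first | omega | simp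

/-- Induction on the level with the Bellman function `4κ (P - κ q² / (κL + S))`, where `P` is the
energy, `q` the integral and `S` the mass below the interval. The subtracted term is what lets
`bellman_step` close the induction. Starting below every level in `K` makes the first sum empty, so
the base case is just Cauchy–Schwarz. -/
theorem dyadic_embedding_aux {P q : ℤ → ℤ → ℝ}
    (hP : ∀ j i, P (j + 1) i = P j (2 * i) + P j (2 * i + 1))
    (hq : ∀ j i, q (j + 1) i = q j (2 * i) + q j (2 * i + 1))
    (hCS : ∀ j i, q j i ^ 2 ≤ 2 ^ j * P j i) (K : Finset ι) (l : ι → ℤ) (p m : ι → ℝ)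
    (hm : ∀ k, 0 ≤ m k) {κ : ℝ} (hκ : 0 < κ)
    (hC : ∀ j i, ∑ k ∈ dyadicBelow K l p j i, m k ≤ κ * 2 ^ j) (j₀ : ℤ)
    (hj₀ : ∀ k ∈ K, j₀ < l k) (n : ℕ) : ∀ i : ℤ,
    ∑ k ∈ dyadicBelow K l p (j₀ + n) i, m k * (q (l k) ⌊p k / 2 ^ l k⌋ / 2 ^ l k) ^ 2 ≤
      4 * κ * (P (j₀ + n) i - κ * q (j₀ + n) i ^ 2 /
        (κ * 2 ^ (j₀ + n) + ∑ k ∈ dyadicBelow K l p (j₀ + n) i, m k)) := by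
  induction n with
  | zero =>
    intro i
    have hempty : dyadicBelow K l p (j₀ + (0 : ℕ)) i = ∅ := by
      rw [dyadicBelow, Finset.filter_eq_empty_iff]
      intro k hk h
      have := hj₀ k hk
      have := h.1
      simp at this
      omega
    rw [hempty]
    simp only [Finset.sum_empty, Nat.cast_zero, add_zero]
    have h2 : (0 : ℝ) < 2 ^ j₀ := by positivity
    have : κ * q j₀ i ^ 2 / (κ * 2 ^ j₀) ≤ P j₀ i := by
      rw [mul_div_mul_left _ _ hκ.ne', div_le_iff₀ h2, mul_comm]
      exact hCS j₀ i
    have := sub_nonneg.2 this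
    positivity
  | succ n ih =>
    intro i
    have hcast : (j₀ + ((n + 1 : ℕ) : ℤ)) = (j₀ + n) + 1 := by push_cast; ring
    have hC' := hC (j₀ + n + 1) i
    rw [hcast]
    generalize hj : j₀ + (n : ℤ) = j at ih hC' ⊢
    rw [sum_dyadicBelow_succ, sum_dyadicBelow_succ]
    rw [sum_dyadicBelow_succ] at hC'
    set α := ∑ k ∈ K.filter (fun k => l k = j + 1 ∧ ⌊p k / 2 ^ (j + 1)⌋ = i), m k with hα
    have h1 : ∑ k ∈ K.filter (fun k => l k = j + 1 ∧ ⌊p k / 2 ^ (j + 1)⌋ = i),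
        m k * (q (l k) ⌊p k / 2 ^ l k⌋ / 2 ^ l k) ^ 2 = α * (q (j + 1) i / 2 ^ (j + 1)) ^ 2 := by
      rw [hα, Finset.sum_mul]
      refine Finset.sum_congr rfl fun k hk => ?_
      rw [Finset.mem_filter] at hk
      rw [hk.2.1, hk.2.2]
    rw [h1]
    have e0 := ih (2 * i)
    have e1 := ih (2 * i + 1)
    have hpow : (2 : ℝ) ^ (j + 1) = 2 * 2 ^ j := by rw [zpow_add_one₀ two_ne_zero]; ring
    have hb := bellman_step (q₀ := q j (2 * i)) (q₁ := q j (2 * i + 1)) hκ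
      (show (0 : ℝ) < 2 ^ j by positivity)
      (show 0 ≤ α from Finset.sum_nonneg fun k _ => hm k)
      (Finset.sum_nonneg fun k _ => hm k : 0 ≤ ∑ k ∈ dyadicBelow K l p j (2 * i), m k)
      (Finset.sum_nonneg fun k _ => hm k : 0 ≤ ∑ k ∈ dyadicBelow K l p j (2 * i + 1), m k)
      (by rw [← hpow]; exact hC')
    rw [hP, hq, hpow]
    linarith

/-- Finite dyadic Carleson embedding theorem for square integrable functions. -/
theorem dyadic_carleson_embedding {F : ℝ → ℝ} (hF : MemLp F 2 volume) (K : Finset ι) (l : ι → ℤ)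
    (p m : ι → ℝ) (hm : ∀ k, 0 ≤ m k) {κ : ℝ} (hκ : 0 < κ)
    (hC : ∀ j i, ∑ k ∈ dyadicBelow K l p j i, m k ≤ κ * 2 ^ j) :
    ∑ k ∈ K, m k * ((∫ t in Ico (⌊p k / 2 ^ l k⌋ * 2 ^ l k : ℝ) ((⌊p k / 2 ^ l k⌋ + 1) * 2 ^ l k),
      F t) / 2 ^ l k) ^ 2 ≤ 4 * κ * ∫ t, F t ^ 2 := by
  classical
  set D : ℤ → ℤ → Set ℝ := fun j i => Ico (i * 2 ^ j : ℝ) ((i + 1) * 2 ^ j) with hD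
  have hDmeas : ∀ j i, MeasurableSet (D j i) := fun j i => measurableSet_Ico
  have hsq : Integrable (fun t => F t ^ 2) := hF.integrable_sq
  have hFint : ∀ j i, IntegrableOn F (D j i) := fun j i =>
    (hF.restrict (D j i)).integrable one_le_two |> fun h => by
      have : IsFiniteMeasure (volume.restrict (D j i)) := ⟨by simp [hD]⟩
      exact (hF.restrict (D j i)).integrable one_le_two
  have hsplit : ∀ j i, D (j + 1) i = D j (2 * i) ∪ D j (2 * i + 1) := by
    intro j i
    have h2 : (0 : ℝ) < 2 ^ j := by positivity
    simp only [hD, zpow_add_one₀ (two_ne_zero (α := ℝ))]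
    push_cast
    rw [show (i : ℝ) * (2 ^ j * 2) = 2 * i * 2 ^ j by ring,
      show ((i : ℝ) + 1) * (2 ^ j * 2) = (2 * i + 1 + 1) * 2 ^ j by ring,
      Ico_union_Ico_eq_Ico] <;> nlinarith
  have hdisj : ∀ j i i', i ≠ i' → Disjoint (D j i) (D j i') := by
    intro j i i' hii
    have h2 : (0 : ℝ) < 2 ^ j := by positivity
    rw [Set.disjoint_left]
    rintro t ⟨a1, a2⟩ ⟨b1, b2⟩
    apply hii
    have c1 : (i : ℝ) < i' + 1 := lt_of_mul_lt_mul_right (a1.trans_lt b2) h2.le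
    have c2 : (i' : ℝ) < i + 1 := lt_of_mul_lt_mul_right (b1.trans_lt a2) h2.le
    have c3 : i < i' + 1 := by exact_mod_cast c1
    have c4 : i' < i + 1 := by exact_mod_cast c2
    omega
  set P : ℤ → ℤ → ℝ := fun j i => ∫ t in D j i, F t ^ 2 with hPdef
  set q : ℤ → ℤ → ℝ := fun j i => ∫ t in D j i, F t with hqdef
  have hP : ∀ j i, P (j + 1) i = P j (2 * i) + P j (2 * i + 1) := fun j i => by
    simp only [hPdef]
    rw [hsplit, setIntegral_union (hdisj _ _ _ (by omega)) (hDmeas _ _) hsq.integrableOn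
      hsq.integrableOn]
  have hq : ∀ j i, q (j + 1) i = q j (2 * i) + q j (2 * i + 1) := fun j i => by
    simp only [hqdef]
    rw [hsplit, setIntegral_union (hdisj _ _ _ (by omega)) (hDmeas _ _) (hFint _ _) (hFint _ _)]
  have hCS : ∀ j i, q j i ^ 2 ≤ 2 ^ j * P j i := by
    intro j i
    have h2 : (0 : ℝ) < 2 ^ j := by positivity
    -- `c` is the mean of `F` over the interval; expanding `∫ (F - c)² ≥ 0` gives Cauchy–Schwarz.
    set c := q j i / 2 ^ j with hc
    have hvol : (volume : Measure ℝ).real (D j i) = 2 ^ j := by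
      simp only [hD]
      rw [Real.volume_real_Ico_of_le (by nlinarith)]; ring
    have hfin : volume (D j i) ≠ ∞ := by simp [hD]
    have h0 : 0 ≤ ∫ t in D j i, (F t - c) ^ 2 := integral_nonneg fun t => sq_nonneg _
    have h3 : ∫ t in D j i, (F t - c) ^ 2 = P j i - 2 * c * q j i + c ^ 2 * 2 ^ j := by
      have : ∀ t, (F t - c) ^ 2 = F t ^ 2 - 2 * c * F t + c ^ 2 := fun t => by ring
      simp_rw [this]
      rw [integral_add, integral_sub, integral_const_mul, setIntegral_const, hvol, smul_eq_mul,
        mul_comm (2 ^ j)]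
      · exact hsq.integrableOn
      · exact (hFint j i).const_mul _
      · exact hsq.integrableOn.sub ((hFint j i).const_mul _)
      · exact integrableOn_const hfin
    rw [h3] at h0
    have h4 : q j i = c * 2 ^ j := by rw [hc]; field_simp
    rw [h4] at h0 ⊢
    nlinarith
  obtain ⟨j₀, hj₀⟩ : ∃ j₀ : ℤ, ∀ k ∈ K, j₀ < l k := by
    obtain ⟨b, hb⟩ := (K.image l).bddBelow
    exact ⟨b - 1, fun k hk => by
      have := hb (by simpa using ⟨k, hk, rfl⟩ : l k ∈ ((K.image l : Finset ℤ) : Set ℤ)); omega⟩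
  obtain ⟨n, hn⟩ : ∃ n : ℕ, ∀ k ∈ K, l k ≤ j₀ + n := by
    obtain ⟨b, hb⟩ := (K.image l).bddAbove
    refine ⟨(b - j₀).toNat, fun k hk => ?_⟩
    have := hb (by simpa using ⟨k, hk, rfl⟩ : l k ∈ ((K.image l : Finset ℤ) : Set ℤ)); omega
  have haux := dyadic_embedding_aux hP hq hCS K l p m hm hκ hC j₀ hj₀ n
  generalize j₀ + (n : ℤ) = J at haux hn
  -- At a level above all of `K` the subtracted term can be dropped; the remaining energies sit on
  -- disjoint intervals and add up.
  have hW : ∀ i, ∑ k ∈ dyadicBelow K l p J i, m k * (q (l k) ⌊p k / 2 ^ l k⌋ / 2 ^ l k) ^ 2 ≤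
      4 * κ * P J i := by
    intro i
    refine (haux i).trans ?_
    have : 0 ≤ κ * q J i ^ 2 / (κ * 2 ^ J + ∑ k ∈ dyadicBelow K l p J i, m k) :=
      div_nonneg (by positivity) (add_nonneg (by positivity) (Finset.sum_nonneg fun k _ => hm k))
    nlinarith
  set T := K.image fun k => ⌊p k / 2 ^ J⌋ with hT
  calc ∑ k ∈ K, m k * (q (l k) ⌊p k / 2 ^ l k⌋ / 2 ^ l k) ^ 2
      = ∑ i ∈ T, ∑ k ∈ K with ⌊p k / 2 ^ J⌋ = i,
          m k * (q (l k) ⌊p k / 2 ^ l k⌋ / 2 ^ l k) ^ 2 :=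
        (Finset.sum_fiberwise_of_maps_to (fun k hk => Finset.mem_image_of_mem _ hk) _).symm
    _ = ∑ i ∈ T, ∑ k ∈ dyadicBelow K l p J i, m k * (q (l k) ⌊p k / 2 ^ l k⌋ / 2 ^ l k) ^ 2 := by
        refine Finset.sum_congr rfl fun i _ => Finset.sum_congr ?_ fun _ _ => rfl
        rw [dyadicBelow]
        exact Finset.filter_congr fun k hk => by simp [hn k hk]
    _ ≤ ∑ i ∈ T, 4 * κ * P J i := Finset.sum_le_sum fun i _ => hW i
    _ = 4 * κ * ∑ i ∈ T, P J i := by rw [Finset.mul_sum]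
    _ = 4 * κ * ∫ t in ⋃ i ∈ T, D J i, F t ^ 2 := by
        rw [integral_biUnion_finset _ (fun i _ => hDmeas _ _)
          (fun i _ i' _ h => hdisj _ _ _ h) (fun i _ => hsq.integrableOn)]
    _ ≤ 4 * κ * ∫ t, F t ^ 2 := by
        refine mul_le_mul_of_nonneg_left ?_ (by positivity)
        exact setIntegral_le_integral hsq (Filter.Eventually.of_forall fun t => sq_nonneg _)

end Dyadic

/-! ### The Gamma integral with complex parameter -/

section GammaIntegral

lemma integrableOn_rpow_mul_exp_neg_mul {s b : ℝ} (hs : 0 < s) (hb : 0 < b) :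
    IntegrableOn (fun r : ℝ => r ^ (s - 1) * Real.exp (-(b * r))) (Ioi 0) := by
  have := integrableOn_rpow_mul_exp_neg_mul_rpow (p := 1) (s := s - 1) (b := b) (by linarith)
    one_pos hb
  simpa [neg_mul] using this

lemma norm_ofReal_mul_cexp (a : ℝ) (r : ℝ) (w : ℂ) (ha : 0 ≤ a) :
    ‖(a : ℂ) * Complex.exp (-(r * w))‖ = a * Real.exp (-(w.re * r)) := by
  rw [norm_mul, Complex.norm_exp, Complex.norm_of_nonneg ha]
  simp [mul_comm]

lemma integrableOn_rpow_mul_cexp_neg_mul {s : ℝ} {w : ℂ} (hs : 0 < s) (hw : 0 < w.re) :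
    IntegrableOn (fun r : ℝ => ((r ^ (s - 1) : ℝ) : ℂ) * Complex.exp (-(r * w))) (Ioi 0) := by
  refine Integrable.mono' (integrableOn_rpow_mul_exp_neg_mul hs hw) ?_ ?_
  · exact Measurable.aestronglyMeasurable (by fun_prop)
  · filter_upwards [ae_restrict_mem measurableSet_Ioi] with r hr
    rw [norm_ofReal_mul_cexp _ _ _ (Real.rpow_nonneg (le_of_lt hr) _)]

/-- Differentiation under the integral sign: for `Re w > Re w₀ / 2` the derivative is dominated by
`r^s e^{-r Re w₀ / 2}`. Holomorphy is what carries the Gamma integral from real to complex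
parameters. -/
lemma differentiableOn_integral_rpow_mul_cexp {s : ℝ} (hs : 0 < s) :
    DifferentiableOn ℂ
      (fun w : ℂ => ∫ r in Ioi (0 : ℝ), ((r ^ (s - 1) : ℝ) : ℂ) * Complex.exp (-(r * w)))
      {w | 0 < w.re} := by
  intro w₀ hw₀
  have hw₀' : 0 < w₀.re := hw₀
  have hopen : IsOpen {w : ℂ | w₀.re / 2 < w.re} := isOpen_lt continuous_const Complex.continuous_re
  have hmem : {w : ℂ | w₀.re / 2 < w.re} ∈ nhds w₀ := hopen.mem_nhds (by simpa using hw₀')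
  have key := hasDerivAt_integral_of_dominated_loc_of_deriv_le (μ := volume.restrict (Ioi (0 : ℝ)))
    (F := fun (w : ℂ) (r : ℝ) => ((r ^ (s - 1) : ℝ) : ℂ) * Complex.exp (-(r * w)))
    (F' := fun (w : ℂ) (r : ℝ) => ((r ^ (s - 1) : ℝ) : ℂ) * (Complex.exp (-(r * w)) * (-r)))
    (bound := fun r : ℝ => r ^ (s + 1 - 1) * Real.exp (-(w₀.re / 2 * r))) (x₀ := w₀) hmem
    (Filter.Eventually.of_forall fun w => Measurable.aestronglyMeasurable (by fun_prop))
    (integrableOn_rpow_mul_cexp_neg_mul hs hw₀)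
    (Measurable.aestronglyMeasurable (by fun_prop)) ?_
    (integrableOn_rpow_mul_exp_neg_mul (by linarith) (by linarith)) ?_
  · exact key.2.differentiableAt.differentiableWithinAt
  · filter_upwards [ae_restrict_mem measurableSet_Ioi] with r hr w hw
    have hr0 : 0 < r := hr
    have hw' : w₀.re / 2 < w.re := hw
    rw [← mul_assoc, norm_mul, norm_ofReal_mul_cexp _ _ _ (Real.rpow_nonneg hr0.le _), norm_neg,
      Complex.norm_of_nonneg hr0.le, mul_right_comm, ← Real.rpow_add_one hr0.ne']
    have : s - 1 + 1 = s + 1 - 1 := by ring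
    rw [this]
    gcongr
  · filter_upwards with r w _
    have h1 : HasDerivAt (fun w : ℂ => -((r : ℂ) * w)) (-r) w := by
      simpa using ((hasDerivAt_id w).const_mul (r : ℂ)).fun_neg
    exact h1.cexp.const_mul _

/-- The Gamma integral `∫₀^∞ r^{s-1} e^{-rw} dr = Γ(s) w^{-s}` for complex `w`. -/
theorem integral_rpow_mul_cexp_neg_mul_Ioi {s : ℝ} (hs : 0 < s) {w : ℂ} (hw : 0 < w.re) :
    ∫ r in Ioi (0 : ℝ), ((r ^ (s - 1) : ℝ) : ℂ) * Complex.exp (-(r * w)) =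
      Real.Gamma s * w ^ (-(s : ℂ)) := by
  have hopen : IsOpen {w : ℂ | 0 < w.re} := isOpen_lt continuous_const Complex.continuous_re
  have hconv : Convex ℝ {w : ℂ | 0 < w.re} := convex_halfSpace_re_gt 0
  have hA := (differentiableOn_integral_rpow_mul_cexp hs).analyticOnNhd hopen
  have hB : AnalyticOnNhd ℂ (fun w : ℂ => Real.Gamma s * w ^ (-(s : ℂ))) {w : ℂ | 0 < w.re} := by
    refine DifferentiableOn.analyticOnNhd (fun w hw => ?_) hopen
    refine DifferentiableAt.differentiableWithinAt ?_
    exact (differentiableAt_id.cpow_const (Or.inl hw)).const_mul _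
  have hreal : ∀ x : ℝ, 0 < x →
      ∫ r in Ioi (0 : ℝ), ((r ^ (s - 1) : ℝ) : ℂ) * Complex.exp (-(r * (x : ℂ))) =
      Real.Gamma s * (x : ℂ) ^ (-(s : ℂ)) := by
    intro x hx
    have h1 := Complex.integral_cpow_mul_exp_neg_mul_Ioi (a := (s : ℂ)) (r := x) (by simpa) hx
    rw [Complex.Gamma_ofReal, one_div, ← Complex.ofReal_inv, ← Complex.ofReal_cpow (by positivity),
      Real.inv_rpow hx.le, ← Real.rpow_neg hx.le, Complex.ofReal_cpow hx.le] at h1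
    rw [mul_comm]
    push_cast at h1
    rw [← h1]
    refine setIntegral_congr_fun measurableSet_Ioi fun r hr => ?_
    have hr0 : 0 < r := hr
    simp only [Complex.ofReal_cpow hr0.le]
    push_cast
    rw [mul_comm (x : ℂ)]
  -- Identity theorem: both sides agree at the real points `1 + 1/(n+1)`, which accumulate at `1`.
  refine hA.eqOn_of_preconnected_of_frequently_eq hB hconv.isPreconnected
    (show (1 : ℂ) ∈ {w : ℂ | 0 < w.re} by simp) ?_ hw
  have hlim : Filter.Tendsto (fun n : ℕ => ((1 + 1 / ((n : ℝ) + 1) : ℝ) : ℂ)) Filter.atTop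
      (nhdsWithin 1 {1}ᶜ) := by
    refine tendsto_nhdsWithin_iff.2 ⟨?_, Filter.Eventually.of_forall fun n => ?_⟩
    · have : Filter.Tendsto (fun n : ℕ => (1 + 1 / ((n : ℝ) + 1) : ℝ)) Filter.atTop (nhds (1 + 0)) :=
        tendsto_const_nhds.add tendsto_one_div_add_atTop_nhds_zero_nat
      have h2 := (Complex.continuous_ofReal.tendsto _).comp this
      simpa [Function.comp_def] using h2
    · have : (1 : ℝ) / ((n : ℝ) + 1) ≠ 0 := by positivity
      simp only [mem_compl_iff, mem_singleton_iff]
      intro h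
      have h' := Complex.ofReal_eq_one.1 h
      exact this (by linarith)
  exact hlim.frequently (Filter.Frequently.of_forall fun n => hreal _ (by positivity))

end GammaIntegral

/-! ### The Fourier transform on `L²(ℝ)` -/

section FourierL2

/-- An element of `L²` and its transform are tied together as tempered distributions. This pairing
with test functions is how the pointwise formulas for `L²` transforms below are obtained. -/
lemma integral_smul_fourier_eq (f : Lp ℂ 2 (volume : Measure ℝ)) {φ : ℝ → ℂ}
    (h1 : ContDiff ℝ (⊤ : ℕ∞) φ) (h2 : HasCompactSupport φ) :
    ∫ ξ, φ ξ • (𝓕 f : Lp ℂ 2 (volume : Measure ℝ)) ξ = ∫ t, 𝓕 φ t • f t := by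
  have h := DFunLike.congr_fun (Lp.fourier_toTemperedDistribution_eq f) (h2.toSchwartzMap h1)
  rw [TemperedDistribution.fourier_apply, Lp.toTemperedDistribution_apply,
    Lp.toTemperedDistribution_apply, SchwartzMap.fourier_coe] at h
  exact h.symm

lemma Lp.locallyIntegrable_of_two (f : Lp ℂ 2 (volume : Measure ℝ)) : LocallyIntegrable f :=
  (Lp.memLp f).locallyIntegrable one_le_two

lemma ae_eq_of_integral_contDiff_mul_eq {f f' : ℝ → ℂ} (hf : LocallyIntegrable f)
    (hf' : LocallyIntegrable f')
    (h : ∀ φ : ℝ → ℂ, ContDiff ℝ (⊤ : ℕ∞) φ → HasCompactSupport φ →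
      ∫ x, φ x • f x = ∫ x, φ x • f' x) : f =ᵐ[volume] f' := by
  refine ae_eq_of_integral_contDiff_smul_eq hf hf' fun g hg hg' => ?_
  have := h (fun x => (g x : ℂ)) (Complex.ofRealCLM.contDiff.comp hg)
    (hg'.comp_left (g := fun x : ℝ => (x : ℂ)) (by simp))
  simpa using this

/-- On `L¹ ∩ L²` the `L²` Fourier transform is given by the Fourier integral. -/
theorem fourier_toLp_ae_eq {f : ℝ → ℂ} (h1 : Integrable f) (h2 : MemLp f 2 volume) :
    (𝓕 (h2.toLp f) : Lp ℂ 2 (volume : Measure ℝ)) =ᵐ[volume] 𝓕 f := by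
  have hcont : Continuous (𝓕 f) :=
    VectorFourier.fourierIntegral_continuous Real.continuous_fourierChar
      (by exact continuous_inner) h1
  refine ae_eq_of_integral_contDiff_mul_eq (Lp.locallyIntegrable_of_two _)
    hcont.locallyIntegrable fun φ hφ hφ' => ?_
  rw [integral_smul_fourier_eq _ hφ hφ']
  have hφi : Integrable φ := hφ.continuous.integrable_of_hasCompactSupport hφ'
  have e1 : ∫ t, 𝓕 φ t • (h2.toLp f) t = ∫ t, 𝓕 φ t • f t := by
    refine integral_congr_ae ?_
    filter_upwards [h2.coeFn_toLp] with t ht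
    rw [ht]
  rw [e1]
  have := VectorFourier.integral_fourierIntegral_smul_eq_flip (L := innerₗ ℝ) (μ := volume)
    (ν := volume) Real.continuous_fourierChar (by exact continuous_inner) hφi h1
  rw [flip_innerₗ] at this
  exact this

/-- Translation on `L²(ℝ)`: `(translateL2 r f)(t) = f(t + r)`. -/
def translateL2 (r : ℝ) : Lp ℂ 2 (volume : Measure ℝ) →ₗᵢ[ℂ] Lp ℂ 2 (volume : Measure ℝ) :=
  Lp.compMeasurePreservingₗᵢ ℂ (fun t => t + r) (measurePreserving_add_right volume r)

lemma coeFn_translateL2 (r : ℝ) (f : Lp ℂ 2 (volume : Measure ℝ)) :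
    translateL2 r f =ᵐ[volume] fun t => f (t + r) :=
  Lp.coeFn_compMeasurePreserving f (measurePreserving_add_right volume r)

lemma ae_comp_add_right {p : ℝ → Prop} (r : ℝ) (h : ∀ᵐ t, p t) : ∀ᵐ t, p (t + r) :=
  (measurePreserving_add_right volume r).quasiMeasurePreserving.ae h

lemma norm_cexp_two_pi_mul (r ξ : ℝ) : ‖Complex.exp (2 * Real.pi * Complex.I * r * ξ)‖ = 1 := by
  rw [Complex.norm_exp]
  simp

/-- The Fourier transform of a translateL2. -/
theorem fourier_translateL2_ae_eq (r : ℝ) (f : Lp ℂ 2 (volume : Measure ℝ)) :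
    (𝓕 (translateL2 r f) : Lp ℂ 2 (volume : Measure ℝ)) =ᵐ[volume]
      fun ξ => Complex.exp (2 * Real.pi * Complex.I * r * ξ) *
        (𝓕 f : Lp ℂ 2 (volume : Measure ℝ)) ξ := by
  have hmem : MemLp (fun ξ : ℝ => Complex.exp (2 * Real.pi * Complex.I * r * ξ) *
      (𝓕 f : Lp ℂ 2 (volume : Measure ℝ)) ξ) 2 volume := by
    refine MemLp.of_le (Lp.memLp (𝓕 f : Lp ℂ 2 (volume : Measure ℝ))) ?_
      (Filter.Eventually.of_forall fun ξ => ?_)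
    · exact (Continuous.aestronglyMeasurable (by fun_prop)).mul (Lp.aestronglyMeasurable _)
    · rw [norm_mul, norm_cexp_two_pi_mul, one_mul]
  refine ae_eq_of_integral_contDiff_mul_eq (Lp.locallyIntegrable_of_two _)
    (hmem.locallyIntegrable one_le_two) fun φ hφ hφ' => ?_
  -- The modulation is moved onto the test function, whose transform it translates; a change of
  -- variables then returns the translation to `f`.
  set ψ : ℝ → ℂ := fun ξ => φ ξ * Complex.exp (2 * Real.pi * Complex.I * r * ξ) with hψ
  have hexp : ContDiff ℝ (⊤ : ℕ∞) fun ξ : ℝ => Complex.exp (2 * Real.pi * Complex.I * r * ξ) := by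
    refine ContDiff.cexp ?_
    exact contDiff_const.mul Complex.ofRealCLM.contDiff
  have e1 : ∫ ξ, φ ξ • (Complex.exp (2 * Real.pi * Complex.I * r * ξ) *
      (𝓕 f : Lp ℂ 2 (volume : Measure ℝ)) ξ) =
      ∫ ξ, ψ ξ • (𝓕 f : Lp ℂ 2 (volume : Measure ℝ)) ξ := by
    simp only [hψ, smul_eq_mul, mul_assoc]
  rw [e1, integral_smul_fourier_eq _ hφ hφ', integral_smul_fourier_eq _ (hφ.mul hexp) hφ'.mul_right]
  have e2 : ∀ t, 𝓕 ψ t = 𝓕 φ (t - r) := by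
    intro t
    rw [Real.fourier_real_eq_integral_exp_smul, Real.fourier_real_eq_integral_exp_smul]
    refine integral_congr_ae (Filter.Eventually.of_forall fun ξ => ?_)
    simp only [hψ, smul_eq_mul]
    rw [mul_left_comm, ← Complex.exp_add, mul_comm]
    congr 2
    push_cast
    ring
  have e3 : ∫ t, 𝓕 φ t • (translateL2 r f) t = ∫ t, 𝓕 φ t • f (t + r) := by
    refine integral_congr_ae ?_
    filter_upwards [coeFn_translateL2 r f] with t ht
    rw [ht]
  rw [e3]
  have e4 : ∫ t, 𝓕 ψ t • f t = ∫ t, 𝓕 φ (t - r) • f t := by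
    simp_rw [e2]
  refine Eq.trans ?_ e4.symm
  rw [← integral_add_right_eq_self (fun t => 𝓕 φ (t - r) • f t) r]
  simp

end FourierL2

/-! ### Causal and anticausal functions -/

section HalfLine

lemma coeFn_zeroExtend (f : L2Half) : zeroExtend f =ᵐ[volume] (Ioi (0 : ℝ)).indicator f :=
  MemLp.coeFn_toLp _

lemma zeroExtend_ae_restrict (f : L2Half) :
    zeroExtend f =ᵐ[volume.restrict (Ioi (0 : ℝ))] f := by
  filter_upwards [ae_restrict_of_ae (coeFn_zeroExtend f), ae_restrict_mem measurableSet_Ioi]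
    with t h1 h2
  rw [h1, indicator_of_mem h2]

lemma norm_zeroExtend (f : L2Half) : ‖zeroExtend f‖ = ‖f‖ := by
  rw [zeroExtend, Lp.norm_toLp, Lp.norm_def,
    eLpNorm_indicator_eq_eLpNorm_restrict measurableSet_Ioi]

lemma zeroExtend_injective : Function.Injective zeroExtend := by
  intro f g h
  refine Lp.ext ?_
  exact (zeroExtend_ae_restrict f).symm.trans (h ▸ zeroExtend_ae_restrict g)

/-- A function in `L²(ℝ)` is causal if it vanishes on the negative half line. -/
def IsCausal (f : Lp ℂ 2 (volume : Measure ℝ)) : Prop := ∀ᵐ t : ℝ, t < 0 → f t = 0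

/-- A function in `L²(ℝ)` is anticausal if it vanishes on the positive half line. -/
def IsAnticausal (f : Lp ℂ 2 (volume : Measure ℝ)) : Prop := ∀ᵐ t : ℝ, 0 < t → f t = 0

lemma isCausal_zeroExtend (f : L2Half) : IsCausal (zeroExtend f) := by
  filter_upwards [coeFn_zeroExtend f] with t ht h0
  rw [ht, indicator_of_notMem (by simpa using h0.le)]

lemma IsCausal.exists_zeroExtend_eq {f : Lp ℂ 2 (volume : Measure ℝ)} (hf : IsCausal f) :
    ∃ h : L2Half, zeroExtend h = f := by
  set h : L2Half := ((Lp.memLp f).restrict (Ioi (0 : ℝ))).toLp f with hh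
  refine ⟨h, Lp.ext ?_⟩
  have h1 : h =ᵐ[volume.restrict (Ioi (0 : ℝ))] f := MemLp.coeFn_toLp _
  have h2 := (ae_restrict_iff' measurableSet_Ioi).1 h1
  have h3 : ∀ᵐ t : ℝ, t ≠ 0 := by simp [ae_iff]
  filter_upwards [coeFn_zeroExtend h, h2, hf, h3] with t e1 e2 e3 e4
  rw [e1]
  rcases lt_or_gt_of_ne e4 with h | h
  · rw [indicator_of_notMem (by simpa using h.le), e3 h]
  · rw [indicator_of_mem (by exact h), e2 h]

lemma IsAnticausal.inner_eq_zero {v f : Lp ℂ 2 (volume : Measure ℝ)} (hv : IsAnticausal v)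
    (hf : IsCausal f) : inner ℂ v f = 0 := by
  rw [L2.inner_def]
  refine integral_eq_zero_of_ae ?_
  have h3 : ∀ᵐ t : ℝ, t ≠ 0 := by simp [ae_iff]
  filter_upwards [hv, hf, h3] with t e1 e2 e4
  rcases lt_or_gt_of_ne e4 with h | h
  · rw [e2 h]; simp
  · rw [e1 h]; simp

/-- Testing against the restriction of `f` to the negative half line shows that this restriction has
norm zero. -/
lemma isCausal_of_forall_inner_eq_zero {f : Lp ℂ 2 (volume : Measure ℝ)}
    (h : ∀ v : Lp ℂ 2 (volume : Measure ℝ), IsAnticausal v → inner ℂ v f = 0) : IsCausal f := by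
  have hmem : MemLp ((Iio (0 : ℝ)).indicator f) 2 volume := (Lp.memLp f).indicator measurableSet_Iio
  have hv : IsAnticausal (hmem.toLp _) := by
    filter_upwards [hmem.coeFn_toLp] with t ht h0
    rw [ht, indicator_of_notMem (by simpa using h0.le)]
  have h1 := h _ hv
  have h2 : inner ℂ (hmem.toLp _) f = inner ℂ (hmem.toLp _) (hmem.toLp _) := by
    rw [L2.inner_def, L2.inner_def]
    refine integral_congr_ae ?_
    filter_upwards [hmem.coeFn_toLp] with t ht
    rw [ht]
    by_cases h0 : t ∈ Iio (0 : ℝ)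
    · rw [indicator_of_mem h0]
    · rw [indicator_of_notMem h0]; simp
  rw [h2, inner_self_eq_zero] at h1
  have h3 := hmem.coeFn_toLp
  rw [h1] at h3
  filter_upwards [h3, Lp.coeFn_zero ℂ 2 (volume : Measure ℝ)] with t e1 e2 h0
  rw [e2, indicator_of_mem (by exact h0)] at e1
  simpa using e1.symm

/-- With `r > 0` the graph moves to the left, away from the positive half line. Averages over such
translations therefore respect causality, by duality. -/
lemma IsAnticausal.translateL2 {v : Lp ℂ 2 (volume : Measure ℝ)} (hv : IsAnticausal v) {r : ℝ}
    (hr : 0 < r) : IsAnticausal (translateL2 r v) := by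
  filter_upwards [coeFn_translateL2 r v, ae_comp_add_right r hv] with t h1 h2 h0
  rw [h1, h2 (by linarith)]

/-- Values at negative times do not matter against a causal function, so a kernel on the half line
may be extended in whatever way is convenient. -/
lemma inner_zeroExtend_of_ae_eq {v : Lp ℂ 2 (volume : Measure ℝ)} {w : L2Half}
    (h : v =ᵐ[volume.restrict (Ioi (0 : ℝ))] w) (f : L2Half) :
    inner ℂ v (zeroExtend f) = inner ℂ w f := by
  rw [L2.inner_def, L2.inner_def]
  have : ∫ t in Ioi (0 : ℝ), inner ℂ (w t) (f t) = ∫ t in Ioi (0 : ℝ), inner ℂ (v t) (zeroExtend f t) := by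
    refine integral_congr_ae ?_
    filter_upwards [h, zeroExtend_ae_restrict f] with t h1 h2
    rw [h1, h2]
  rw [this]
  refine (setIntegral_eq_integral_of_ae_compl_eq_zero ?_).symm
  filter_upwards [coeFn_zeroExtend f] with t ht h0
  rw [ht, indicator_of_notMem h0]
  simp

end HalfLine

/-! ### Reproducing kernels of the Laplace transform -/

section LaplaceKernel

lemma memLp_laplaceKernel {z : ℂ} (hz : 0 < z.re) :
    MemLp (fun t : ℝ => Complex.exp (-(t : ℂ) * conj z)) 2 (volume.restrict (Ioi (0 : ℝ))) := by
  rw [memLp_two_iff_integrable_sq_norm (Continuous.aestronglyMeasurable (by fun_prop))]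
  have h := integrableOn_exp_mul_Ioi (a := -(2 * z.re)) (by linarith) 0
  refine h.congr (Filter.Eventually.of_forall fun t => ?_)
  simp only [Complex.norm_exp]
  rw [← Real.exp_nat_mul]
  congr 1
  simp
  ring

/-- The kernel `t ↦ e^{-t conj z}` representing the Laplace transform at `z`. -/
def laplaceKernel (z : ℂ) (hz : 0 < z.re) : L2Half := (memLp_laplaceKernel hz).toLp _

lemma coeFn_laplaceKernel {z : ℂ} (hz : 0 < z.re) :
    laplaceKernel z hz =ᵐ[volume.restrict (Ioi (0 : ℝ))]
      fun t : ℝ => Complex.exp (-(t : ℂ) * conj z) :=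
  MemLp.coeFn_toLp _

lemma conj_cexp_neg_mul_conj (t : ℝ) (z : ℂ) :
    conj (Complex.exp (-(t : ℂ) * conj z)) = Complex.exp (-(t : ℂ) * z) := by
  rw [← Complex.exp_conj]
  simp

lemma inner_laplaceKernel {z : ℂ} (hz : 0 < z.re) (f : L2Half) :
    inner ℂ (laplaceKernel z hz) f = laplaceTransform f z := by
  rw [L2.inner_def, laplaceTransform]
  refine integral_congr_ae ?_
  filter_upwards [coeFn_laplaceKernel hz] with t ht
  rw [RCLike.inner_apply, ht, conj_cexp_neg_mul_conj, mul_comm]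

/-- This identifies the Gram matrix of the kernels as a Cauchy matrix, which makes finite
interpolation explicit. -/
lemma laplaceTransform_laplaceKernel {z : ℂ} (hz : 0 < z.re) {w : ℂ} (hw : 0 < w.re) :
    laplaceTransform (laplaceKernel w hw) z = 1 / (z + conj w) := by
  have h1 : laplaceTransform (laplaceKernel w hw) z =
      ∫ t in Ioi (0 : ℝ), Complex.exp (-(z + conj w) * t) := by
    rw [laplaceTransform]
    refine integral_congr_ae ?_
    filter_upwards [coeFn_laplaceKernel hw] with t ht
    rw [ht, ← Complex.exp_add]
    congr 1
    ring
  rw [h1, integral_exp_mul_complex_Ioi (by simp; linarith)]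
  rw [Complex.ofReal_zero, mul_zero, Complex.exp_zero, neg_div_neg_eq]

lemma norm_sq_laplaceKernel {z : ℂ} (hz : 0 < z.re) :
    ‖laplaceKernel z hz‖ ^ 2 = 1 / (2 * z.re) := by
  have h := inner_laplaceKernel hz (laplaceKernel z hz)
  rw [laplaceTransform_laplaceKernel hz, inner_self_eq_norm_sq_to_K, Complex.add_conj] at h
  apply Complex.ofReal_injective
  simpa using h

end LaplaceKernel

/-! ### Negative powers as averages of translations -/

section Multipliers

lemma re_add_two_pi_I_mul (δ ξ : ℝ) : ((δ : ℂ) + 2 * (Real.pi : ℂ) * Complex.I * ξ).re = δ := by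
  simp

lemma continuous_multiplier_cpow {δ : ℝ} (hδ : 0 < δ) (s : ℂ) :
    Continuous fun ξ : ℝ => ((δ : ℂ) + 2 * (Real.pi : ℂ) * Complex.I * ξ) ^ s := by
  refine Continuous.cpow (by fun_prop) continuous_const fun ξ => Or.inl ?_
  rw [re_add_two_pi_I_mul]; exact hδ

lemma le_norm_add_two_pi_I_mul {δ : ℝ} (ξ : ℝ) :
    δ ≤ ‖(δ : ℂ) + 2 * (Real.pi : ℂ) * Complex.I * ξ‖ := by
  have h := (Complex.abs_re_le_norm ((δ : ℂ) + 2 * (Real.pi : ℂ) * Complex.I * ξ))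
  rw [re_add_two_pi_I_mul] at h
  exact (le_abs_self δ).trans h

lemma norm_multiplier_cpow_neg_le {δ : ℝ} (hδ : 0 < δ) {s : ℝ} (hs : 0 < s) (ξ : ℝ) :
    ‖((δ : ℂ) + 2 * (Real.pi : ℂ) * Complex.I * ξ) ^ (-(s : ℂ))‖ ≤ δ ^ (-s) := by
  rw [← Complex.ofReal_neg, Complex.norm_cpow_real]
  exact Real.rpow_le_rpow_of_nonpos hδ (le_norm_add_two_pi_I_mul ξ) (by linarith)

lemma inner_eq_integral_fourier (v f : Lp ℂ 2 (volume : Measure ℝ)) :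
    inner ℂ v f = ∫ ξ, conj ((𝓕 v : Lp ℂ 2 (volume : Measure ℝ)) ξ) *
      (𝓕 f : Lp ℂ 2 (volume : Measure ℝ)) ξ := by
  rw [← Lp.inner_fourier_eq, L2.inner_def]
  refine integral_congr_ae (Filter.Eventually.of_forall fun ξ => ?_)
  simp only [RCLike.inner_apply, mul_comm]

lemma inner_translateL2_eq (v f : Lp ℂ 2 (volume : Measure ℝ)) (r : ℝ) :
    inner ℂ (translateL2 r v) f = ∫ ξ : ℝ, Complex.exp (-(r * (2 * Real.pi * Complex.I * ξ))) *
      (conj ((𝓕 v : Lp ℂ 2 (volume : Measure ℝ)) ξ) *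
        (𝓕 f : Lp ℂ 2 (volume : Measure ℝ)) ξ) := by
  rw [inner_eq_integral_fourier]
  refine integral_congr_ae ?_
  filter_upwards [fourier_translateL2_ae_eq r v] with ξ h
  rw [h, map_mul, ← Complex.exp_conj, mul_assoc]
  congr 2
  simp only [map_mul, map_ofNat, Complex.conj_ofReal, Complex.conj_I]
  ring

/-- The multiplier `(δ + 2πiξ)^{-s}` as an average of translations. -/
theorem integral_conj_fourier_mul_multiplier (v f : Lp ℂ 2 (volume : Measure ℝ)) {δ s : ℝ}
    (hδ : 0 < δ) (hs : 0 < s) :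
    Real.Gamma s * ∫ ξ, conj ((𝓕 v : Lp ℂ 2 (volume : Measure ℝ)) ξ) *
      (((δ : ℂ) + 2 * (Real.pi : ℂ) * Complex.I * ξ) ^ (-(s : ℂ)) *
        (𝓕 f : Lp ℂ 2 (volume : Measure ℝ)) ξ) =
      ∫ r in Ioi (0 : ℝ), ((r ^ (s - 1) : ℝ) : ℂ) * Complex.exp (-(r * (δ : ℂ))) *
        inner ℂ (translateL2 r v) f := by
  set G : ℝ → ℂ := fun ξ => conj ((𝓕 v : Lp ℂ 2 (volume : Measure ℝ)) ξ) *
    (𝓕 f : Lp ℂ 2 (volume : Measure ℝ)) ξ with hG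
  have hGi : Integrable G := by
    refine (L2.integrable_inner (𝕜 := ℂ) (𝓕 v : Lp ℂ 2 (volume : Measure ℝ)) (𝓕 f)).congr ?_
    exact Filter.Eventually.of_forall fun ξ => by simp [hG, RCLike.inner_apply, mul_comm]
  have hγ := integrableOn_rpow_mul_cexp_neg_mul (w := (δ : ℂ)) hs (by simpa)
  have hswap : Integrable (Function.uncurry fun (r : ℝ) (ξ : ℝ) =>
      ((r ^ (s - 1) : ℝ) : ℂ) * Complex.exp (-(r * (δ : ℂ))) *
        (Complex.exp (-(r * (2 * Real.pi * Complex.I * ξ))) * G ξ))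
      ((volume.restrict (Ioi (0 : ℝ))).prod volume) := by
    -- Fubini applies because the oscillating exponential has modulus one, leaving a product of two
    -- integrable functions.
    have h0 := Integrable.mul_prod hγ hGi
    refine h0.mono ?_ (Filter.Eventually.of_forall fun x => ?_)
    · have h1 : AEStronglyMeasurable (fun x : ℝ × ℝ =>
          Complex.exp (-(x.1 * (2 * Real.pi * Complex.I * x.2))))
          ((volume.restrict (Ioi (0 : ℝ))).prod volume) :=
        Continuous.aestronglyMeasurable (by fun_prop)
      refine (h1.mul h0.aestronglyMeasurable).congr (Filter.Eventually.of_forall fun x => ?_)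
      simp only [Function.uncurry, Pi.mul_apply]
      ring
    · simp only [Function.uncurry, norm_mul]
      have : ‖Complex.exp (-(x.1 * (2 * Real.pi * Complex.I * x.2)))‖ = 1 := by
        rw [Complex.norm_exp]; simp
      rw [this, one_mul]
  calc Real.Gamma s * ∫ ξ, conj ((𝓕 v : Lp ℂ 2 (volume : Measure ℝ)) ξ) *
      (((δ : ℂ) + 2 * (Real.pi : ℂ) * Complex.I * ξ) ^ (-(s : ℂ)) *
        (𝓕 f : Lp ℂ 2 (volume : Measure ℝ)) ξ)
      = ∫ ξ : ℝ, ∫ r in Ioi (0 : ℝ), ((r ^ (s - 1) : ℝ) : ℂ) * Complex.exp (-(r * (δ : ℂ))) *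
        (Complex.exp (-(r * (2 * Real.pi * Complex.I * ξ))) * G ξ) := by
        rw [← integral_const_mul]
        refine integral_congr_ae (Filter.Eventually.of_forall fun ξ => ?_)
        have h1 := integral_rpow_mul_cexp_neg_mul_Ioi hs
          (w := (δ : ℂ) + 2 * (Real.pi : ℂ) * Complex.I * ξ) (by rwa [re_add_two_pi_I_mul])
        have h2 : ∀ r : ℝ, ((r ^ (s - 1) : ℝ) : ℂ) * Complex.exp (-(r * (δ : ℂ))) *
            (Complex.exp (-(r * (2 * Real.pi * Complex.I * ξ))) * G ξ) =
            (((r ^ (s - 1) : ℝ) : ℂ) *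
              Complex.exp (-(r * ((δ : ℂ) + 2 * (Real.pi : ℂ) * Complex.I * ξ)))) * G ξ := by
          intro r
          rw [mul_add, neg_add, Complex.exp_add]
          ring
        simp_rw [h2]
        rw [integral_mul_const, h1, hG]
        ring
    _ = ∫ r in Ioi (0 : ℝ), ∫ ξ : ℝ, ((r ^ (s - 1) : ℝ) : ℂ) * Complex.exp (-(r * (δ : ℂ))) *
        (Complex.exp (-(r * (2 * Real.pi * Complex.I * ξ))) * G ξ) :=
        (integral_integral_swap hswap).symm
    _ = _ := by
        refine integral_congr_ae (Filter.Eventually.of_forall fun r => ?_)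
        simp only
        rw [integral_const_mul, inner_translateL2_eq]

/-- A square integrable function is the Fourier transform of its inverse Fourier transform. -/
lemma fourier_fourierInv_toLp_ae_eq {u : ℝ → ℂ} (hu : MemLp u 2 volume) :
    (𝓕 (𝓕⁻ (hu.toLp u) : Lp ℂ 2 (volume : Measure ℝ)) : Lp ℂ 2 (volume : Measure ℝ))
      =ᵐ[volume] u := by
  rw [FourierTransform.fourier_fourierInv_eq]
  exact hu.coeFn_toLp

/-- Multiplication of the Fourier transform by `(δ + 2πiξ)^{-s}` acts on `L²(0,∞)` and multiplies the
Laplace transform by `(δ + z)^{-s}`. -/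
theorem exists_fourier_eq_multiplier_mul (h : L2Half) {δ s : ℝ} (hδ : 0 < δ) (hs : 0 < s) :
    ∃ f : L2Half, ((𝓕 (zeroExtend f) : Lp ℂ 2 (volume : Measure ℝ)) =ᵐ[volume] fun ξ =>
        ((δ : ℂ) + 2 * (Real.pi : ℂ) * Complex.I * ξ) ^ (-(s : ℂ)) *
          (𝓕 (zeroExtend h) : Lp ℂ 2 (volume : Measure ℝ)) ξ) ∧
      ∀ z : ℂ, 0 < z.re →
        laplaceTransform f z = ((δ : ℂ) + z) ^ (-(s : ℂ)) * laplaceTransform h z := by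
  set m : ℝ → ℂ := fun ξ => ((δ : ℂ) + 2 * (Real.pi : ℂ) * Complex.I * ξ) ^ (-(s : ℂ)) with hm
  have hmem : MemLp (fun ξ => m ξ * (𝓕 (zeroExtend h) : Lp ℂ 2 (volume : Measure ℝ)) ξ) 2
      volume := by
    refine MemLp.of_le_mul (c := δ ^ (-s)) (Lp.memLp (𝓕 (zeroExtend h)))
      ((continuous_multiplier_cpow hδ _).aestronglyMeasurable.mul (Lp.aestronglyMeasurable _))
      (Filter.Eventually.of_forall fun ξ => ?_)
    rw [norm_mul]
    exact mul_le_mul_of_nonneg_right (norm_multiplier_cpow_neg_le hδ hs ξ) (norm_nonneg _)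
  set u : Lp ℂ 2 (volume : Measure ℝ) := 𝓕⁻ (hmem.toLp _) with hu
  have hFu : (𝓕 u : Lp ℂ 2 (volume : Measure ℝ)) =ᵐ[volume] fun ξ =>
      m ξ * (𝓕 (zeroExtend h) : Lp ℂ 2 (volume : Measure ℝ)) ξ :=
    fourier_fourierInv_toLp_ae_eq hmem
  have hΓ : (Real.Gamma s : ℂ) ≠ 0 := by exact_mod_cast (Real.Gamma_pos_of_pos hs).ne'
  have hinner : ∀ v : Lp ℂ 2 (volume : Measure ℝ), Real.Gamma s * inner ℂ v u =
      ∫ r in Ioi (0 : ℝ), ((r ^ (s - 1) : ℝ) : ℂ) * Complex.exp (-(r * (δ : ℂ))) *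
        inner ℂ (translateL2 r v) (zeroExtend h) := by
    intro v
    rw [← integral_conj_fourier_mul_multiplier v _ hδ hs, inner_eq_integral_fourier]
    congr 1
    refine integral_congr_ae ?_
    filter_upwards [hFu] with ξ hξ
    rw [hξ]
  -- For anticausal `v` every translate in `hinner` is anticausal, so the integrand vanishes.
  have hcausal : IsCausal u := by
    refine isCausal_of_forall_inner_eq_zero fun v hv => ?_
    have h1 := hinner v
    rw [setIntegral_congr_fun (g := fun _ => (0 : ℂ)) measurableSet_Ioi, integral_zero] at h1
    · exact (mul_eq_zero.1 h1).resolve_left hΓ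
    · intro r hr
      simp only
      rw [(hv.translateL2 hr).inner_eq_zero (isCausal_zeroExtend h), mul_zero]
  obtain ⟨f, hf⟩ := hcausal.exists_zeroExtend_eq
  refine ⟨f, by rw [hf]; exact hFu, fun z hz => ?_⟩
  have h1 := hinner (zeroExtend (laplaceKernel z hz))
  rw [← hf, inner_zeroExtend_of_ae_eq (zeroExtend_ae_restrict _), inner_laplaceKernel] at h1
  -- On the half line, a translated kernel is the kernel times `e^{-r conj z}`; integrating these
  -- factors gives the Gamma integral at `δ + z`.
  have h2 : ∀ r : ℝ, 0 < r → inner ℂ (translateL2 r (zeroExtend (laplaceKernel z hz)))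
      (zeroExtend h) = Complex.exp (-(r * z)) * laplaceTransform h z := by
    intro r hr
    have h3 : translateL2 r (zeroExtend (laplaceKernel z hz)) =ᵐ[volume.restrict (Ioi (0 : ℝ))]
        ((Complex.exp (-(r * conj z)) • laplaceKernel z hz : L2Half) : ℝ → ℂ) := by
      have h4 := (ae_restrict_iff' measurableSet_Ioi).1
        ((zeroExtend_ae_restrict (laplaceKernel z hz)).trans (coeFn_laplaceKernel hz))
      filter_upwards [ae_restrict_of_ae (ae_comp_add_right r h4), ae_restrict_mem measurableSet_Ioi,
        ae_restrict_of_ae (coeFn_translateL2 r (zeroExtend (laplaceKernel z hz))),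
        coeFn_laplaceKernel hz, Lp.coeFn_smul (Complex.exp (-(r * conj z))) (laplaceKernel z hz)]
        with t e1 e2 e3 e4 e5
      have e2' : 0 < t := e2
      rw [e3, e1 (by simp only [mem_Ioi]; linarith), e5, Pi.smul_apply, e4, smul_eq_mul,
        ← Complex.exp_add]
      congr 1
      push_cast
      ring
    rw [inner_zeroExtend_of_ae_eq h3, inner_smul_left, inner_laplaceKernel, ← Complex.exp_conj]
    simp
  rw [setIntegral_congr_fun (g := fun r : ℝ => ((r ^ (s - 1) : ℝ) : ℂ) *
    Complex.exp (-(r * ((δ : ℂ) + z))) * laplaceTransform h z) measurableSet_Ioi,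
    integral_mul_const, integral_rpow_mul_cexp_neg_mul_Ioi hs (by simp; linarith), mul_assoc] at h1
  · exact mul_left_cancel₀ hΓ h1
  · intro r hr
    simp only
    rw [h2 r hr, mul_add, neg_add, Complex.exp_add]
    ring

end Multipliers

/-! ### Integral forms of the `L²` norm and pairing -/

section L2Norm

variable {α : Type*} {m : MeasurableSpace α} {μ : Measure α}

lemma integral_norm_sq_eq_norm_sq (f : Lp ℂ 2 μ) : ∫ t, ‖f t‖ ^ 2 ∂μ = ‖f‖ ^ 2 := by
  have h : inner ℂ f f = ∫ t, ((‖f t‖ ^ 2 : ℝ) : ℂ) ∂μ := by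
    rw [L2.inner_def]
    refine integral_congr_ae (Filter.Eventually.of_forall fun t => ?_)
    simp only [inner_self_eq_norm_sq_to_K]
    push_cast
    rfl
  rw [integral_complex_ofReal, inner_self_eq_norm_sq_to_K] at h
  apply Complex.ofReal_injective
  rw [← h]
  push_cast
  rfl

lemma integrable_norm_sq (f : Lp ℂ 2 μ) : Integrable (fun t => ‖f t‖ ^ 2) μ :=
  (memLp_two_iff_integrable_sq_norm (Lp.aestronglyMeasurable f)).1 (Lp.memLp f)

lemma integrable_conj_mul {u v : α → ℂ} (hu : MemLp u 2 μ) (hv : MemLp v 2 μ) :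
    Integrable (fun t => conj (u t) * v t) μ := by
  refine (L2.integrable_inner (𝕜 := ℂ) (hu.toLp u) (hv.toLp v)).congr ?_
  filter_upwards [hu.coeFn_toLp, hv.coeFn_toLp] with t h1 h2
  rw [h1, h2, RCLike.inner_apply, mul_comm]

end L2Norm

/-! ### Positive powers and causality -/

section Causality

lemma add_two_pi_I_mul_ne_zero {δ : ℝ} (hδ : 0 < δ) (ξ : ℝ) :
    (δ : ℂ) + 2 * (Real.pi : ℂ) * Complex.I * ξ ≠ 0 := by
  intro h
  have := congrArg Complex.re h
  rw [re_add_two_pi_I_mul] at this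
  exact hδ.ne' this

lemma cpow_neg_ofReal_one (w : ℂ) : w ^ (-((1 : ℝ) : ℂ)) = w⁻¹ := by
  rw [Complex.ofReal_one, Complex.cpow_neg_one]

lemma fourier_injective_of_ae_eq {f g : Lp ℂ 2 (volume : Measure ℝ)}
    (h : (𝓕 f : Lp ℂ 2 (volume : Measure ℝ)) =ᵐ[volume] (𝓕 g : Lp ℂ 2 (volume : Measure ℝ))) :
    f = g := by
  have h2 : (𝓕 f : Lp ℂ 2 (volume : Measure ℝ)) = 𝓕 g := Lp.ext h
  exact (Lp.fourierTransformₗᵢ ℝ ℂ).injective h2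

/-- Causality can be recovered after multiplication of the Fourier transform by `(δ + 2πiξ)⁻¹`. -/
theorem isCausal_of_fourier_eq_inv_mul {f : Lp ℂ 2 (volume : Measure ℝ)} {h : L2Half} {δ : ℝ}
    (hδ : 0 < δ) (hf : (𝓕 (zeroExtend h) : Lp ℂ 2 (volume : Measure ℝ)) =ᵐ[volume] fun ξ =>
      ((δ : ℂ) + 2 * (Real.pi : ℂ) * Complex.I * ξ)⁻¹ *
        (𝓕 f : Lp ℂ 2 (volume : Measure ℝ)) ξ) : IsCausal f := by
  refine isCausal_of_forall_inner_eq_zero fun v hv => ?_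
  set G : ℝ → ℂ := fun ξ => conj ((𝓕 v : Lp ℂ 2 (volume : Measure ℝ)) ξ) *
    (𝓕 f : Lp ℂ 2 (volume : Measure ℝ)) ξ with hG
  have hGi : Integrable G := integrable_conj_mul (Lp.memLp _) (Lp.memLp _)
  -- With `N = n + 1` and `f̂ = (δ + iω) ĥ`, partial fractions give `N / (N + iω) f̂ = N ĥ + N (δ -
  -- N) ĥ / (N + iω)`, a combination of transforms of causal functions. As `N → ∞` the multiplier
  -- tends boundedly to `1`, leaving `f̂`.
  have hzero : ∀ n : ℕ, ∫ ξ : ℝ, ((n : ℂ) + 1) /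
      (((n : ℂ) + 1) + 2 * (Real.pi : ℂ) * Complex.I * ξ) * G ξ = 0 := by
    intro n
    obtain ⟨k, hk, -⟩ := exists_fourier_eq_multiplier_mul h (δ := (n : ℝ) + 1) (s := 1)
      (by positivity) one_pos
    have e1 := hv.inner_eq_zero (isCausal_zeroExtend h)
    have e2 := hv.inner_eq_zero (isCausal_zeroExtend k)
    rw [inner_eq_integral_fourier] at e1 e2
    have e3 : ∫ ξ : ℝ, (((n : ℂ) + 1) * (conj ((𝓕 v : Lp ℂ 2 (volume : Measure ℝ)) ξ) *
        (𝓕 (zeroExtend h) : Lp ℂ 2 (volume : Measure ℝ)) ξ) +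
        ((n : ℂ) + 1) * (δ - ((n : ℂ) + 1)) * (conj ((𝓕 v : Lp ℂ 2 (volume : Measure ℝ)) ξ) *
        (𝓕 (zeroExtend k) : Lp ℂ 2 (volume : Measure ℝ)) ξ)) = 0 := by
      rw [integral_add, integral_const_mul, integral_const_mul, e1, e2]
      · simp
      · exact (integrable_conj_mul (Lp.memLp _) (Lp.memLp _)).const_mul _
      · exact (integrable_conj_mul (Lp.memLp _) (Lp.memLp _)).const_mul _
    rw [← e3]
    refine integral_congr_ae ?_
    filter_upwards [hf, hk] with ξ h1 h2
    have a1 := add_two_pi_I_mul_ne_zero hδ ξ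
    have a2 := add_two_pi_I_mul_ne_zero (show (0 : ℝ) < (n : ℝ) + 1 by positivity) ξ
    rw [h2, h1, cpow_neg_ofReal_one, hG]
    push_cast at a2 ⊢
    field_simp
    ring
  have hlim : Filter.Tendsto (fun n : ℕ => ∫ ξ : ℝ, ((n : ℂ) + 1) /
      (((n : ℂ) + 1) + 2 * (Real.pi : ℂ) * Complex.I * ξ) * G ξ) Filter.atTop
      (nhds (∫ ξ, G ξ)) := by
    refine tendsto_integral_of_dominated_convergence (fun ξ => ‖G ξ‖) (fun n => ?_) hGi.norm
      (fun n => Filter.Eventually.of_forall fun ξ => ?_) (Filter.Eventually.of_forall fun ξ => ?_)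
    · exact (Measurable.aestronglyMeasurable (by fun_prop)).mul hGi.aestronglyMeasurable
    · rw [norm_mul]
      refine mul_le_of_le_one_left (norm_nonneg _) ?_
      rw [norm_div]
      refine div_le_one_of_le₀ ?_ (norm_nonneg _)
      have := le_norm_add_two_pi_I_mul (δ := (n : ℝ) + 1) ξ
      push_cast at this
      refine le_trans (le_of_eq ?_) this
      have h0 : ((n : ℂ) + 1) = (((n : ℝ) + 1 : ℝ) : ℂ) := by push_cast; rfl
      rw [h0, Complex.norm_of_nonneg (by positivity)]
    · have h1 : Filter.Tendsto (fun n : ℕ =>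
          (1 + 2 * (Real.pi : ℂ) * Complex.I * ξ * (1 / ((n : ℂ) + 1)))⁻¹ * G ξ) Filter.atTop
          (nhds ((1 + 2 * (Real.pi : ℂ) * Complex.I * ξ * 0)⁻¹ * G ξ)) := by
        refine Filter.Tendsto.mul_const _ (Filter.Tendsto.inv₀ ?_ (by simp))
        exact tendsto_const_nhds.add (tendsto_one_div_add_atTop_nhds_zero_nat.const_mul _)
      simp only [mul_zero, add_zero, inv_one, one_mul] at h1
      refine h1.congr fun n => ?_
      have a1 : ((n : ℂ) + 1) ≠ 0 := Nat.cast_add_one_ne_zero n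
      have a2 := add_two_pi_I_mul_ne_zero (show (0 : ℝ) < (n : ℝ) + 1 by positivity) ξ
      push_cast at a2
      congr 1
      rw [inv_eq_one_div, div_eq_div_iff _ a2]
      · field_simp
      · intro h0
        apply a2
        have : ((n : ℂ) + 1) * (1 + 2 * (Real.pi : ℂ) * Complex.I * ξ * (1 / ((n : ℂ) + 1))) = 0 := by
          rw [h0, mul_zero]
        rw [← this]
        field_simp
  simp_rw [hzero] at hlim
  rw [inner_eq_integral_fourier]
  exact tendsto_nhds_unique hlim tendsto_const_nhds |>.trans rfl

/-- Multiplying the Fourier transform of a causal function by a power of `δ + 2πiξ` gives a causal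
function, provided that the result is square integrable. -/
theorem isCausal_of_fourier_eq_cpow_mul {f : L2Half} {δ : ℝ} (hδ : 0 < δ) (k : ℕ) :
    ∀ (s : ℝ), s < k → ∀ g : Lp ℂ 2 (volume : Measure ℝ),
      ((𝓕 g : Lp ℂ 2 (volume : Measure ℝ)) =ᵐ[volume] fun ξ =>
        ((δ : ℂ) + 2 * (Real.pi : ℂ) * Complex.I * ξ) ^ (s : ℂ) *
          (𝓕 (zeroExtend f) : Lp ℂ 2 (volume : Measure ℝ)) ξ) → IsCausal g := by
  -- For `s < 0` the multiplier is an average of translations. Otherwise one factor `δ + 2πiξ` is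
  -- divided out, which lowers `s` by one, and causality is then recovered.
  induction k with
  | zero =>
    intro s hs g hg
    obtain ⟨f', hf', -⟩ := exists_fourier_eq_multiplier_mul f hδ (s := -s) (by simpa using hs)
    have : g = zeroExtend f' := by
      refine fourier_injective_of_ae_eq (hg.trans ?_)
      refine Filter.EventuallyEq.trans ?_ hf'.symm
      simp
    rw [this]
    exact isCausal_zeroExtend f'
  | succ k ih =>
    intro s hs g hg
    have hmem : MemLp (fun ξ : ℝ => ((δ : ℂ) + 2 * (Real.pi : ℂ) * Complex.I * ξ)⁻¹ *
        (𝓕 g : Lp ℂ 2 (volume : Measure ℝ)) ξ) 2 volume := by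
      refine MemLp.of_le_mul (c := δ ^ (-(1 : ℝ))) (Lp.memLp (𝓕 g : Lp ℂ 2 (volume : Measure ℝ)))
        ((Measurable.aestronglyMeasurable (by fun_prop)).mul (Lp.aestronglyMeasurable _))
        (Filter.Eventually.of_forall fun ξ => ?_)
      rw [norm_mul, ← cpow_neg_ofReal_one]
      exact mul_le_mul_of_nonneg_right (norm_multiplier_cpow_neg_le hδ one_pos ξ) (norm_nonneg _)
    have hF := fourier_fourierInv_toLp_ae_eq hmem
    have hc : IsCausal (𝓕⁻ (hmem.toLp _) : Lp ℂ 2 (volume : Measure ℝ)) := by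
      refine ih (s - 1) (by push_cast at hs; linarith) _ ?_
      filter_upwards [hF, hg] with ξ h1 h2
      have a1 := add_two_pi_I_mul_ne_zero hδ ξ
      rw [h1, h2, ← mul_assoc, Complex.ofReal_sub, Complex.ofReal_one]
      rw [Complex.cpow_sub _ _ a1, Complex.cpow_one, div_eq_mul_inv, mul_comm (_⁻¹)]
    obtain ⟨h, hh⟩ := hc.exists_zeroExtend_eq
    exact isCausal_of_fourier_eq_inv_mul (h := h) hδ (by rw [hh]; exact hF)

end Causality

/-! ### The Sobolev space as `(1 + z)^{-β}` times the transform of `L²` -/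

section Sobolev

variable {β : ℝ}

lemma norm_two_pi_I_mul_cpow_le (hβ : 0 < β) (ξ : ℝ) :
    ‖(2 * (Real.pi : ℂ) * Complex.I * ξ) ^ (β : ℂ)‖ ≤
      ‖((1 : ℝ) + 2 * (Real.pi : ℂ) * Complex.I * ξ) ^ (β : ℂ)‖ := by
  rw [Complex.norm_cpow_real, Complex.norm_cpow_real]
  refine Real.rpow_le_rpow (norm_nonneg _) ?_ hβ.le
  have h1 : ‖2 * (Real.pi : ℂ) * Complex.I * ξ‖ =
      |((1 : ℝ) + 2 * (Real.pi : ℂ) * Complex.I * ξ).im| := by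
    simp [abs_mul]
  rw [h1]
  exact Complex.abs_im_le_norm _

lemma norm_add_two_pi_I_mul_cpow_le (hβ : 0 < β) {δ : ℝ} (hδ : 0 < δ) (hδ1 : δ ≤ 1) (ξ : ℝ) :
    ‖((δ : ℂ) + 2 * (Real.pi : ℂ) * Complex.I * ξ) ^ (β : ℂ)‖ ≤
      2 ^ β * max 1 ‖(2 * (Real.pi : ℂ) * Complex.I * ξ) ^ (β : ℂ)‖ := by
  rw [Complex.norm_cpow_real, Complex.norm_cpow_real]
  set a := ‖2 * (Real.pi : ℂ) * Complex.I * ξ‖ with ha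
  have ha0 : 0 ≤ a := norm_nonneg _
  have h1 : ‖(δ : ℂ) + 2 * (Real.pi : ℂ) * Complex.I * ξ‖ ≤ 2 * max 1 a := by
    refine (norm_add_le _ _).trans ?_
    rw [Complex.norm_of_nonneg hδ.le, two_mul (max 1 a)]
    exact add_le_add (hδ1.trans (le_max_left _ _)) (le_max_right _ _)
  refine (Real.rpow_le_rpow (norm_nonneg _) h1 hβ.le).trans ?_
  rw [Real.mul_rpow two_pos.le (by positivity)]
  refine mul_le_mul_of_nonneg_left ?_ (by positivity)
  rcases le_total 1 a with h | h
  · rw [max_eq_right h]; exact le_max_right _ _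
  · rw [max_eq_left h, Real.one_rpow]; exact le_max_left _ _

/-- The operator of multiplication of the Laplace transform by `(1 + z)^{-β}` maps `L²(0,∞)` boundedly
into the Sobolev space. -/
theorem exists_sobolev_laplaceTransform_eq (hβ : 0 < β) (h : L2Half) :
    ∃ f : SobolevHalf β, sobolevNorm f ≤ Real.sqrt 2 * ‖h‖ ∧
      ∀ z : ℂ, 0 < z.re → laplaceTransform f.1 z = (1 + z) ^ (-(β : ℂ)) * laplaceTransform h z := by
  obtain ⟨f, hf, hL⟩ := exists_fourier_eq_multiplier_mul h one_pos hβ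
  have hsym : ∀ᵐ ξ, ‖fracDerivSymbol β f ξ‖ ≤
      ‖(𝓕 (zeroExtend h) : Lp ℂ 2 (volume : Measure ℝ)) ξ‖ := by
    filter_upwards [hf] with ξ hξ
    have a1 := add_two_pi_I_mul_ne_zero one_pos ξ
    rw [fracDerivSymbol, hξ, ← mul_assoc, norm_mul, norm_mul]
    refine mul_le_of_le_one_left (norm_nonneg _) ?_
    rw [Complex.cpow_neg, norm_inv, ← div_eq_mul_inv]
    exact div_le_one_of_le₀ (norm_two_pi_I_mul_cpow_le hβ ξ) (norm_nonneg _)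
  have hmem : MemLp (fracDerivSymbol β f) 2 volume := by
    refine MemLp.of_le (Lp.memLp (𝓕 (zeroExtend h))) ?_ hsym
    exact (Measurable.aestronglyMeasurable (by fun_prop)).mul (Lp.aestronglyMeasurable _)
  obtain ⟨F, rfl⟩ : ∃ F : SobolevHalf β, F.1 = f := ⟨⟨f, hmem⟩, rfl⟩
  refine ⟨F, ?_, fun z hz => by simpa using hL z hz⟩
  have h1 : ‖F.1‖ ≤ ‖h‖ := by
    rw [← norm_zeroExtend F.1, ← norm_zeroExtend h, ← Lp.norm_fourier_eq (zeroExtend F.1),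
      ← Lp.norm_fourier_eq (zeroExtend h)]
    refine Lp.norm_le_norm_of_ae_le ?_
    filter_upwards [hf] with ξ hξ
    rw [hξ, norm_mul]
    refine mul_le_of_le_one_left (norm_nonneg _) ?_
    simpa using norm_multiplier_cpow_neg_le one_pos hβ ξ
  have h2 : ‖fracDeriv F‖ ≤ ‖h‖ := by
    rw [← norm_zeroExtend h, ← Lp.norm_fourier_eq (zeroExtend h), ← Lp.norm_fourier_eq (fracDeriv F),
      fracDeriv, FourierTransform.fourier_fourierInv_eq]
    refine Lp.norm_le_norm_of_ae_le ?_
    filter_upwards [hsym, F.2.coeFn_toLp] with ξ a1 a2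
    rw [a2]
    exact a1
  -- For an upper bound on the norm, restricting to the half line only helps.
  have h3 : ∫ t in Ioi (0 : ℝ), ‖fracDeriv F t‖ ^ 2 ≤
      ‖fracDeriv F‖ ^ 2 := by
    rw [← integral_norm_sq_eq_norm_sq]
    exact setIntegral_le_integral (integrable_norm_sq _)
      (Filter.Eventually.of_forall fun t => sq_nonneg _)
  rw [sobolevNorm, integral_norm_sq_eq_norm_sq]
  refine Real.sqrt_le_iff.2 ⟨by positivity, ?_⟩
  rw [mul_pow, Real.sq_sqrt two_pos.le]
  have h4 : ‖F.1‖ ^ 2 ≤ ‖h‖ ^ 2 := pow_le_pow_left₀ (norm_nonneg _) h1 2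
  have h5 := pow_le_pow_left₀ (norm_nonneg _) h2 2
  change ‖F.1‖ ^ 2 + _ ≤ _
  linarith

/-- The bound is uniform in `δ ≤ 1`, so it also provides the majorant for the limit `δ → 0`. -/
lemma fracDerivSymbol_bound (hβ : 0 < β) (f : L2Half) {δ : ℝ} (hδ : 0 < δ) (hδ1 : δ ≤ 1) (ξ : ℝ) :
    ‖((δ : ℂ) + 2 * (Real.pi : ℂ) * Complex.I * ξ) ^ (β : ℂ) *
        (𝓕 (zeroExtend f) : Lp ℂ 2 (volume : Measure ℝ)) ξ‖ ≤
      2 ^ β * max ‖(𝓕 (zeroExtend f) : Lp ℂ 2 (volume : Measure ℝ)) ξ‖ ‖fracDerivSymbol β f ξ‖ := by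
  rw [fracDerivSymbol, norm_mul, norm_mul]
  refine (mul_le_mul_of_nonneg_right (norm_add_two_pi_I_mul_cpow_le hβ hδ hδ1 ξ)
    (norm_nonneg _)).trans ?_
  rw [mul_assoc, max_mul_of_nonneg _ _ (norm_nonneg _), one_mul]

lemma memLp_cpow_mul_fourier (hβ : 0 < β) (f : SobolevHalf β) {δ : ℝ} (hδ : 0 < δ) (hδ1 : δ ≤ 1) :
    MemLp (fun ξ : ℝ => ((δ : ℂ) + 2 * (Real.pi : ℂ) * Complex.I * ξ) ^ (β : ℂ) *
      (𝓕 (zeroExtend f.1) : Lp ℂ 2 (volume : Measure ℝ)) ξ) 2 volume := by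
  refine MemLp.of_le_mul (c := 2 ^ β)
    ((Lp.memLp (𝓕 (zeroExtend f.1) : Lp ℂ 2 (volume : Measure ℝ))).norm.add f.2.norm)
    ((continuous_multiplier_cpow hδ _).aestronglyMeasurable.mul (Lp.aestronglyMeasurable _))
    (Filter.Eventually.of_forall fun ξ => ?_)
  refine (fracDerivSymbol_bound hβ f.1 hδ hδ1 ξ).trans ?_
  refine mul_le_mul_of_nonneg_left ?_ (by positivity)
  rw [Pi.add_apply, Real.norm_of_nonneg (by positivity)]
  exact max_le_add_of_nonneg (norm_nonneg _) (norm_nonneg _)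

lemma isCausal_fourierInv_cpow_mul (hβ : 0 < β) (f : SobolevHalf β) {δ : ℝ} (hδ : 0 < δ)
    (hδ1 : δ ≤ 1) :
    IsCausal (𝓕⁻ ((memLp_cpow_mul_fourier hβ f hδ hδ1).toLp _) : Lp ℂ 2 (volume : Measure ℝ)) := by
  obtain ⟨k, hk⟩ := exists_nat_gt β
  exact isCausal_of_fourier_eq_cpow_mul hδ k β hk _ (fourier_fourierInv_toLp_ae_eq _)

/-- The Sobolev norm sees the derivative only on the half line; causality shows that nothing is
lost. The symbol `(iω)^β` lies on the boundary of the range of the multiplier theorem, so it is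
reached as the limit of `(δ + iω)^β` as `δ → 0`. -/
theorem isCausal_fracDeriv (hβ : 0 < β) (f : SobolevHalf β) : IsCausal (fracDeriv f) := by
  refine isCausal_of_forall_inner_eq_zero fun v hv => ?_
  set δ : ℕ → ℝ := fun n => 1 / ((n : ℝ) + 1) with hδ
  have hδ0 : ∀ n, 0 < δ n := fun n => by simp only [hδ]; positivity
  have hδ1 : ∀ n, δ n ≤ 1 := fun n => by
    simp only [hδ]
    rw [div_le_one (by positivity)]
    linarith [(Nat.cast_nonneg n : (0 : ℝ) ≤ n)]
  have hF : (𝓕 (fracDeriv f) : Lp ℂ 2 (volume : Measure ℝ)) =ᵐ[volume] fracDerivSymbol β f.1 :=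
    fourier_fourierInv_toLp_ae_eq f.2
  have hzero : ∀ n, ∫ ξ : ℝ, conj ((𝓕 v : Lp ℂ 2 (volume : Measure ℝ)) ξ) *
      (((δ n : ℂ) + 2 * (Real.pi : ℂ) * Complex.I * ξ) ^ (β : ℂ) *
        (𝓕 (zeroExtend f.1) : Lp ℂ 2 (volume : Measure ℝ)) ξ) = 0 := by
    intro n
    rw [← hv.inner_eq_zero (isCausal_fourierInv_cpow_mul hβ f (hδ0 n) (hδ1 n)),
      inner_eq_integral_fourier]
    refine integral_congr_ae ?_
    filter_upwards [fourier_fourierInv_toLp_ae_eq (memLp_cpow_mul_fourier hβ f (hδ0 n) (hδ1 n))]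
      with ξ hξ
    rw [hξ]
  have hlim : Filter.Tendsto (fun n => ∫ ξ : ℝ, conj ((𝓕 v : Lp ℂ 2 (volume : Measure ℝ)) ξ) *
      (((δ n : ℂ) + 2 * (Real.pi : ℂ) * Complex.I * ξ) ^ (β : ℂ) *
        (𝓕 (zeroExtend f.1) : Lp ℂ 2 (volume : Measure ℝ)) ξ)) Filter.atTop
      (nhds (∫ ξ : ℝ, conj ((𝓕 v : Lp ℂ 2 (volume : Measure ℝ)) ξ) * fracDerivSymbol β f.1 ξ)) := by
    refine tendsto_integral_of_dominated_convergence
      (fun ξ => 2 ^ β * (‖conj ((𝓕 v : Lp ℂ 2 (volume : Measure ℝ)) ξ) *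
        (𝓕 (zeroExtend f.1) : Lp ℂ 2 (volume : Measure ℝ)) ξ‖ +
        ‖conj ((𝓕 v : Lp ℂ 2 (volume : Measure ℝ)) ξ) * fracDerivSymbol β f.1 ξ‖))
      (fun n => ?_) ?_ (fun n => Filter.Eventually.of_forall fun ξ => ?_) ?_
    · exact (integrable_conj_mul (Lp.memLp _)
        (memLp_cpow_mul_fourier hβ f (hδ0 n) (hδ1 n))).aestronglyMeasurable
    · exact ((integrable_conj_mul (Lp.memLp _) (Lp.memLp _)).norm.add
        (integrable_conj_mul (Lp.memLp _) f.2).norm).const_mul _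
    · rw [norm_mul]
      refine (mul_le_mul_of_nonneg_left (fracDerivSymbol_bound hβ f.1 (hδ0 n) (hδ1 n) ξ)
        (norm_nonneg _)).trans ?_
      rw [norm_mul, norm_mul, ← mul_add, mul_left_comm]
      gcongr
      exact max_le_add_of_nonneg (norm_nonneg _) (norm_nonneg _)
    -- Away from `ξ = 0` the point `2πiξ` is in the slit plane, where the principal power is
    -- continuous.
    · have h3 : ∀ᵐ t : ℝ, t ≠ 0 := by simp [ae_iff]
      filter_upwards [h3] with ξ hξ
      refine Filter.Tendsto.const_mul _ (Filter.Tendsto.mul_const _ ?_)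
      have hslit : 2 * (Real.pi : ℂ) * Complex.I * ξ ∈ Complex.slitPlane := by
        right
        simp [hξ, Real.pi_ne_zero]
      have hc : ContinuousAt (fun w : ℂ => w ^ (β : ℂ)) (2 * (Real.pi : ℂ) * Complex.I * ξ) :=
        continuousAt_id.cpow continuousAt_const hslit
      have ht : Filter.Tendsto (fun n => (δ n : ℂ) + 2 * (Real.pi : ℂ) * Complex.I * ξ) Filter.atTop
          (nhds (2 * (Real.pi : ℂ) * Complex.I * ξ)) := by
        have h0 : Filter.Tendsto (fun n => ((δ n : ℝ) : ℂ)) Filter.atTop (nhds ((0 : ℝ) : ℂ)) :=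
          (Complex.continuous_ofReal.tendsto 0).comp tendsto_one_div_add_atTop_nhds_zero_nat
        simpa using h0.add_const (2 * (Real.pi : ℂ) * Complex.I * ξ)
      exact hc.tendsto.comp ht
  simp_rw [hzero] at hlim
  rw [inner_eq_integral_fourier]
  refine Eq.trans ?_ (tendsto_nhds_unique hlim tendsto_const_nhds)
  refine integral_congr_ae ?_
  filter_upwards [hF] with ξ hξ
  rw [hξ]

lemma IsCausal.setIntegral_norm_sq {f : Lp ℂ 2 (volume : Measure ℝ)} (hf : IsCausal f) :
    ∫ t in Ioi (0 : ℝ), ‖f t‖ ^ 2 = ‖f‖ ^ 2 := by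
  rw [← integral_norm_sq_eq_norm_sq]
  refine setIntegral_eq_integral_of_ae_compl_eq_zero ?_
  have h3 : ∀ᵐ t : ℝ, t ≠ 0 := by simp [ae_iff]
  filter_upwards [hf, h3] with t ht h0 hmem
  rw [ht (lt_of_le_of_ne (by simpa using hmem) h0)]
  simp

lemma sobolevNorm_sq (hβ : 0 < β) (f : SobolevHalf β) :
    sobolevNorm f ^ 2 = ‖f.1‖ ^ 2 + ‖fracDeriv f‖ ^ 2 := by
  rw [sobolevNorm, Real.sq_sqrt, integral_norm_sq_eq_norm_sq,
    (isCausal_fracDeriv hβ f).setIntegral_norm_sq]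
  exact add_nonneg (integral_nonneg fun t => sq_nonneg _) (integral_nonneg fun t => sq_nonneg _)

/-- Every element of the Sobolev space is obtained from an `L²(0,∞)` function of comparable norm by
multiplying the Laplace transform by `(1 + z)^{-β}`. -/
theorem exists_laplaceTransform_eq_of_sobolev (hβ : 0 < β) (f : SobolevHalf β) :
    ∃ h : L2Half, ‖h‖ ≤ 2 ^ β * sobolevNorm f ∧
      ∀ z : ℂ, 0 < z.re → laplaceTransform f.1 z = (1 + z) ^ (-(β : ℂ)) * laplaceTransform h z := by
  obtain ⟨h, hh⟩ := (isCausal_fourierInv_cpow_mul hβ f one_pos le_rfl).exists_zeroExtend_eq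
  have hF : (𝓕 (zeroExtend h) : Lp ℂ 2 (volume : Measure ℝ)) =ᵐ[volume] fun ξ =>
      (((1 : ℝ) : ℂ) + 2 * (Real.pi : ℂ) * Complex.I * ξ) ^ (β : ℂ) *
        (𝓕 (zeroExtend f.1) : Lp ℂ 2 (volume : Measure ℝ)) ξ := by
    rw [hh]
    exact fourier_fourierInv_toLp_ae_eq (memLp_cpow_mul_fourier hβ f one_pos le_rfl)
  refine ⟨h, ?_, ?_⟩
  · have hN : 0 ≤ sobolevNorm f := Real.sqrt_nonneg _
    refine (sq_le_sq₀ (norm_nonneg _) (by positivity)).1 ?_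
    rw [mul_pow, sobolevNorm_sq hβ, ← norm_zeroExtend h, ← Lp.norm_fourier_eq (zeroExtend h),
      ← norm_zeroExtend f.1, ← Lp.norm_fourier_eq (zeroExtend f.1),
      ← Lp.norm_fourier_eq (fracDeriv f), ← integral_norm_sq_eq_norm_sq,
      ← integral_norm_sq_eq_norm_sq, ← integral_norm_sq_eq_norm_sq,
      ← integral_add (integrable_norm_sq _) (integrable_norm_sq _), ← integral_const_mul]
    refine integral_mono_ae (integrable_norm_sq _)
      (((integrable_norm_sq _).add (integrable_norm_sq _)).const_mul _) ?_
    have hD : (𝓕 (fracDeriv f) : Lp ℂ 2 (volume : Measure ℝ)) =ᵐ[volume] fracDerivSymbol β f.1 :=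
      fourier_fourierInv_toLp_ae_eq f.2
    filter_upwards [hF, hD] with ξ h1 h2
    rw [h1, h2]
    refine (pow_le_pow_left₀ (norm_nonneg _)
      (fracDerivSymbol_bound hβ f.1 one_pos le_rfl ξ) 2).trans ?_
    rw [mul_pow]
    refine mul_le_mul_of_nonneg_left ?_ (by positivity)
    rcases le_total ‖(𝓕 (zeroExtend f.1) : Lp ℂ 2 (volume : Measure ℝ)) ξ‖
      ‖fracDerivSymbol β f.1 ξ‖ with hle | hle
    · rw [max_eq_right hle]; nlinarith [sq_nonneg ‖(𝓕 (zeroExtend f.1) : Lp ℂ 2 (volume : Measure ℝ)) ξ‖]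
    · rw [max_eq_left hle]; nlinarith [sq_nonneg ‖fracDerivSymbol β f.1 ξ‖]
  -- Applying the multiplier `(1 + 2πiξ)^{-β}` to `h` undoes the power, so injectivity of the
  -- Fourier transform returns `f`.
  · obtain ⟨f', hf', hL⟩ := exists_fourier_eq_multiplier_mul h one_pos hβ
    have : f.1 = f' := by
      refine zeroExtend_injective (fourier_injective_of_ae_eq ?_)
      filter_upwards [hf', hF] with ξ h1 h2
      have a1 := add_two_pi_I_mul_ne_zero one_pos ξ
      rw [h1, h2, ← mul_assoc, ← Complex.cpow_add _ _ a1]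
      simp
    intro z hz
    rw [this]
    simpa using hL z hz

end Sobolev

/-! ### Domination by the Poisson kernel -/

section PoissonKernel

lemma integrable_exp_neg_mul_abs {a : ℝ} (ha : 0 < a) :
    Integrable fun t : ℝ => Real.exp (-(a * |t|)) := by
  rw [← integrableOn_univ, ← Iic_union_Ioi (a := (0 : ℝ))]
  refine IntegrableOn.union ?_ ?_
  · refine (integrableOn_exp_mul_Iic ha 0).congr_fun (fun t ht => ?_) measurableSet_Iic
    simp only [abs_of_nonpos (mem_Iic.1 ht)]
    congr 1; ring
  · refine (integrableOn_exp_mul_Ioi (a := -a) (by linarith) 0).congr_fun (fun t ht => ?_)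
      measurableSet_Ioi
    simp only [abs_of_pos (mem_Ioi.1 ht)]
    congr 1; ring

/-- The two-sided extension `t ↦ e^{-x|t| + iyt}` of the kernel `e^{-t conj z}`, `z = x + iy`. -/
def twoSidedKernel (z : ℂ) (t : ℝ) : ℂ := Complex.exp (-(z.re * |t| : ℝ) + z.im * t * Complex.I)

lemma norm_twoSidedKernel (z : ℂ) (t : ℝ) : ‖twoSidedKernel z t‖ = Real.exp (-(z.re * |t|)) := by
  rw [twoSidedKernel, Complex.norm_exp]
  simp

lemma continuous_twoSidedKernel (z : ℂ) : Continuous (twoSidedKernel z) := by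
  unfold twoSidedKernel
  fun_prop

lemma integrable_twoSidedKernel {z : ℂ} (hz : 0 < z.re) : Integrable (twoSidedKernel z) := by
  refine (integrable_norm_iff (continuous_twoSidedKernel z).aestronglyMeasurable).1 ?_
  simp_rw [norm_twoSidedKernel]
  exact integrable_exp_neg_mul_abs hz

lemma memLp_twoSidedKernel {z : ℂ} (hz : 0 < z.re) : MemLp (twoSidedKernel z) 2 volume := by
  rw [memLp_two_iff_integrable_sq_norm (continuous_twoSidedKernel z).aestronglyMeasurable]
  refine (integrable_exp_neg_mul_abs (a := 2 * z.re) (by linarith)).congr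
    (Filter.Eventually.of_forall fun t => ?_)
  simp only [norm_twoSidedKernel]
  rw [← Real.exp_nat_mul]
  congr 1
  push_cast
  ring

/-- The Fourier transform of the two-sided kernel is the Poisson kernel. -/
lemma fourier_twoSidedKernel {z : ℂ} (hz : 0 < z.re) (ξ : ℝ) :
    𝓕 (twoSidedKernel z) ξ =
      ((2 * z.re / (z.re ^ 2 + (2 * Real.pi * ξ - z.im) ^ 2) : ℝ) : ℂ) := by
  rw [Real.fourier_real_eq_integral_exp_smul]
  set η : ℝ := 2 * Real.pi * ξ - z.im with hη
  have hint : Integrable fun t : ℝ =>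
      Complex.exp (↑(-2 * Real.pi * t * ξ) * Complex.I) • twoSidedKernel z t := by
    refine (integrable_norm_iff ?_).1 ?_
    · have := continuous_twoSidedKernel z
      exact Continuous.aestronglyMeasurable (by fun_prop)
    · simp_rw [norm_smul, Complex.norm_exp_ofReal_mul_I, one_mul]
      exact (integrable_twoSidedKernel hz).norm
  rw [← integral_add_compl measurableSet_Ioi hint (s := Ioi (0 : ℝ)), compl_Ioi]
  have h1 : ∫ t in Ioi (0 : ℝ),
      Complex.exp (↑(-2 * Real.pi * t * ξ) * Complex.I) • twoSidedKernel z t =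
      ∫ t in Ioi (0 : ℝ), Complex.exp (-(z.re + η * Complex.I) * t) := by
    refine setIntegral_congr_fun measurableSet_Ioi fun t ht => ?_
    simp only [twoSidedKernel, abs_of_pos (mem_Ioi.1 ht), smul_eq_mul, ← Complex.exp_add, hη]
    congr 1
    push_cast
    ring
  have h2 : ∫ t in Iic (0 : ℝ),
      Complex.exp (↑(-2 * Real.pi * t * ξ) * Complex.I) • twoSidedKernel z t =
      ∫ t in Iic (0 : ℝ), Complex.exp ((z.re - η * Complex.I) * t) := by
    refine setIntegral_congr_fun measurableSet_Iic fun t ht => ?_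
    simp only [twoSidedKernel, abs_of_nonpos (mem_Iic.1 ht), smul_eq_mul, ← Complex.exp_add, hη]
    congr 1
    push_cast
    ring
  rw [h1, h2, integral_exp_mul_complex_Ioi (by simpa), integral_exp_mul_complex_Iic (by simpa)]
  have a1 : (z.re : ℂ) + η * Complex.I ≠ 0 := fun h => by
    have := congrArg Complex.re h; simp at this; linarith
  have a2 : (z.re : ℂ) - η * Complex.I ≠ 0 := fun h => by
    have := congrArg Complex.re h; simp at this; linarith
  have a3 : (z.re : ℂ) ^ 2 + (η : ℂ) ^ 2 = (z.re + η * Complex.I) * (z.re - η * Complex.I) := by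
    ring_nf; rw [Complex.I_sq]; ring
  push_cast
  rw [a3]
  simp only [mul_zero, Complex.exp_zero]
  field_simp
  ring

/-- The Laplace transform is dominated by the Poisson integral of the Fourier transform. -/
lemma enorm_laplaceTransform_le {z : ℂ} (hz : 0 < z.re) (h : L2Half) :
    ‖laplaceTransform h z‖ₑ ≤ ∫⁻ ξ : ℝ,
      ENNReal.ofReal (2 * z.re / (z.re ^ 2 + (2 * Real.pi * ξ - z.im) ^ 2)) *
        ‖(𝓕 (zeroExtend h) : Lp ℂ 2 (volume : Measure ℝ)) ξ‖ₑ := by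
  -- The two-sided extension does not change the pairing with a causal function, but its transform
  -- is the nonnegative, quadratically decaying Poisson kernel; the zero extension would give a
  -- kernel decaying only like `1/|ξ|`.
  have hv : ((memLp_twoSidedKernel hz).toLp _ : Lp ℂ 2 (volume : Measure ℝ))
      =ᵐ[volume.restrict (Ioi (0 : ℝ))] laplaceKernel z hz := by
    filter_upwards [ae_restrict_of_ae (memLp_twoSidedKernel hz).coeFn_toLp, coeFn_laplaceKernel hz,
      ae_restrict_mem measurableSet_Ioi] with t h1 h2 h3
    rw [h1, h2, twoSidedKernel, abs_of_pos (mem_Ioi.1 h3)]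
    congr 1
    apply Complex.ext <;> simp <;> ring
  rw [← inner_laplaceKernel hz, ← inner_zeroExtend_of_ae_eq hv, inner_eq_integral_fourier]
  refine (enorm_integral_le_lintegral_enorm _).trans (le_of_eq (lintegral_congr_ae ?_))
  filter_upwards [fourier_toLp_ae_eq (integrable_twoSidedKernel hz) (memLp_twoSidedKernel hz)]
    with ξ hξ
  rw [hξ, fourier_twoSidedKernel hz, Complex.conj_ofReal, enorm_mul]
  congr 1
  rw [← ofReal_norm, Complex.norm_of_nonneg (by positivity)]

/-- `n` is the first index with `|s| < 2^{l+n}`. If `n > 0` then `|s| ≥ 2^{l+n-1}`, so the kernel is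
at most `2^{l+1} / 2^{2(l+n-1)}`, which is the stated bound; if `n = 0` it is at most `1/X`. -/
lemma exists_poisson_le {X s : ℝ} {l : ℤ} (h1 : 2 ^ l ≤ X) (h2 : X < 2 ^ (l + 1)) :
    ∃ n : ℕ, |s| < 2 ^ (l + n) ∧ X / (X ^ 2 + s ^ 2) ≤ 8 * (1 / 2) ^ n / 2 ^ (l + n) := by
  have hl : (0 : ℝ) < 2 ^ l := by positivity
  have hX : 0 < X := hl.trans_le h1
  rw [zpow_add_one₀ two_ne_zero] at h2
  have hex : ∃ n : ℕ, |s| < 2 ^ (l + n) := by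
    obtain ⟨n, hn⟩ := pow_unbounded_of_one_lt (|s| / 2 ^ l) one_lt_two
    refine ⟨n, ?_⟩
    rw [div_lt_iff₀ hl] at hn
    rw [zpow_add₀ two_ne_zero, zpow_natCast, mul_comm]
    exact hn
  classical
  refine ⟨Nat.find hex, Nat.find_spec hex, ?_⟩
  rcases hn : Nat.find hex with _ | n
  · simp only [pow_zero, Nat.cast_zero, add_zero]
    rw [div_le_div_iff₀ (by positivity) hl]
    nlinarith [sq_nonneg s]
  · have h3 : 2 ^ (l + n) ≤ |s| := not_lt.1 (Nat.find_min hex (by omega : n < Nat.find hex))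
    have e1 : (2 : ℝ) ^ (l + n) = 2 ^ l * 2 ^ n := by rw [zpow_add₀ two_ne_zero, zpow_natCast]
    have e2 : (2 : ℝ) ^ (l + (n + 1 : ℕ)) = 2 ^ l * (2 * 2 ^ n) := by
      rw [zpow_add₀ two_ne_zero, zpow_natCast, pow_succ]; ring
    rw [e1] at h3
    have h4 : (2 ^ l * 2 ^ n) ^ 2 ≤ s ^ 2 := by rw [← sq_abs s]; gcongr
    have h5 : X / (X ^ 2 + s ^ 2) ≤ (2 ^ l * 2) / (2 ^ l * 2 ^ n) ^ 2 := by
      gcongr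
      nlinarith [sq_nonneg X]
    refine h5.trans (le_of_eq ?_)
    rw [e2, one_div, inv_pow, pow_succ]
    field_simp
    rw [pow_succ]
    ring

/-- A point within `L` of `Y` lies in the dyadic interval of `Y` or in a neighbour. The three shifts
`-L, 0, L` of `Y` thus replace centred averages by dyadic ones. -/
lemma mem_dyadic_of_abs_sub_lt {ξ Y L : ℝ} (hL : 0 < L) (h : |ξ - Y| < L) :
    ∃ σ : Fin 3, ξ ∈ Ico (⌊(Y + ((σ : ℕ) - 1 : ℝ) * L) / L⌋ * L : ℝ)
      ((⌊(Y + ((σ : ℕ) - 1 : ℝ) * L) / L⌋ + 1) * L) := by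
  have key : ∀ σ : Fin 3, ⌊ξ / L⌋ = ⌊Y / L⌋ + ((σ : ℕ) - 1 : ℤ) →
      ξ ∈ Ico (⌊(Y + ((σ : ℕ) - 1 : ℝ) * L) / L⌋ * L : ℝ)
      ((⌊(Y + ((σ : ℕ) - 1 : ℝ) * L) / L⌋ + 1) * L) := by
    intro σ hσ
    have h1 : (Y + ((σ : ℕ) - 1 : ℝ) * L) / L = Y / L + (((σ : ℕ) - 1 : ℤ) : ℝ) := by
      push_cast; field_simp
    rw [h1, Int.floor_add_intCast, ← hσ]
    exact ⟨(le_div_iff₀ hL).1 (Int.floor_le _), (div_lt_iff₀ hL).1 (Int.lt_floor_add_one _)⟩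
  rw [abs_lt] at h
  have h1 : ξ / L < Y / L + 1 := by
    rw [div_add_one hL.ne']; gcongr; linarith
  have h2 : Y / L < ξ / L + 1 := by
    rw [div_add_one hL.ne']; gcongr; linarith
  have h3 : ⌊ξ / L⌋ < ⌊Y / L⌋ + 2 := by
    rw [Int.floor_lt]; push_cast; linarith [Int.lt_floor_add_one (Y / L)]
  have h4 : ⌊Y / L⌋ < ⌊ξ / L⌋ + 2 := by
    rw [Int.floor_lt]; push_cast; linarith [Int.lt_floor_add_one (ξ / L)]
  have h5 : ⌊ξ / L⌋ = ⌊Y / L⌋ - 1 ∨ ⌊ξ / L⌋ = ⌊Y / L⌋ ∨ ⌊ξ / L⌋ = ⌊Y / L⌋ + 1 := by omega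
  rcases h5 with h | h | h
  · exact ⟨0, key 0 (by rw [h]; norm_num; ring)⟩
  · exact ⟨1, key 1 (by rw [h]; norm_num)⟩
  · exact ⟨2, key 2 (by rw [h]; norm_num)⟩

end PoissonKernel

/-! ### The Carleson embedding theorem -/

section Embedding

/-- Weighted Cauchy–Schwarz. The superfluous factor `2` comes from using `x y ≤ x² + y²`, which
needs no finiteness in `[0,∞]`. -/
lemma ENNReal.tsum_mul_sq_le {ι : Type*} (w a : ι → ℝ≥0∞) :
    (∑' i, w i * a i) ^ 2 ≤ 2 * (∑' i, w i) * ∑' i, w i * a i ^ 2 := by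
  have h0 : ∀ x y : ℝ≥0∞, x * y ≤ x ^ 2 + y ^ 2 := by
    intro x y
    rcases le_total x y with h | h
    · exact (mul_le_mul_left h y).trans ((sq y).symm.le.trans le_add_self)
    · exact (mul_le_mul_right h x).trans ((sq x).symm.le.trans le_self_add)
  calc (∑' i, w i * a i) ^ 2 = ∑' i, ∑' j, w i * w j * (a i * a j) := by
        rw [sq, ← ENNReal.tsum_mul_right]
        refine tsum_congr fun i => ?_
        rw [← ENNReal.tsum_mul_left]
        exact tsum_congr fun j => by ring
    _ ≤ ∑' i, ∑' j, (w i * w j * a i ^ 2 + w i * w j * a j ^ 2) := by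
        refine ENNReal.tsum_le_tsum fun i => ENNReal.tsum_le_tsum fun j => ?_
        rw [← mul_add]
        gcongr
        exact h0 _ _
    _ = (∑' i, w i * a i ^ 2) * (∑' j, w j) + (∑' i, w i) * ∑' j, w j * a j ^ 2 := by
        rw [← ENNReal.tsum_mul_right, ← ENNReal.tsum_mul_right, ← ENNReal.tsum_add]
        refine tsum_congr fun i => ?_
        rw [ENNReal.tsum_add, ← ENNReal.tsum_mul_left, ← ENNReal.tsum_mul_left]
        congr 1 <;> exact tsum_congr fun j => by ring
    _ = _ := by ring

/-- The average of `|𝓕 h|` over the dyadic interval of level `l` containing `p`. -/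
def dyadicAverage (h : L2Half) (l : ℤ) (p : ℝ) : ℝ :=
  (∫ t in Ico (⌊p / 2 ^ l⌋ * 2 ^ l : ℝ) ((⌊p / 2 ^ l⌋ + 1) * 2 ^ l),
    ‖(𝓕 (zeroExtend h) : Lp ℂ 2 (volume : Measure ℝ)) t‖) / 2 ^ l

/-- The Laplace transform is dominated by a sum of dyadic averages of the Fourier transform. -/
lemma enorm_laplaceTransform_le_tsum {z : ℂ} (hz : 0 < z.re) (h : L2Half) {l : ℤ}
    (h1 : 2 ^ l ≤ z.re / (2 * Real.pi)) (h2 : z.re / (2 * Real.pi) < 2 ^ (l + 1)) :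
    ‖laplaceTransform h z‖ₑ ≤ ∑' i : ℕ × Fin 3, ENNReal.ofReal (8 * (1 / 2) ^ i.1) *
      ENNReal.ofReal (dyadicAverage h (l + i.1)
        (z.im / (2 * Real.pi) + ((i.2 : ℕ) - 1 : ℝ) * 2 ^ (l + i.1))) := by
  set X := z.re / (2 * Real.pi) with hX
  set Y := z.im / (2 * Real.pi) with hY
  set u : ℝ → ℂ := ⇑(𝓕 (zeroExtend h) : Lp ℂ 2 (volume : Measure ℝ)) with hu
  have hum : MemLp u 2 volume := Lp.memLp _
  set D : ℕ × Fin 3 → Set ℝ := fun i =>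
    Ico (⌊(Y + ((i.2 : ℕ) - 1 : ℝ) * 2 ^ (l + i.1)) / 2 ^ (l + i.1)⌋ * 2 ^ (l + i.1) : ℝ)
      ((⌊(Y + ((i.2 : ℕ) - 1 : ℝ) * 2 ^ (l + i.1)) / 2 ^ (l + i.1)⌋ + 1) * 2 ^ (l + i.1)) with hD
  -- Frequencies are rescaled by `2π`; this produces a factor `1/π`, which is bounded by `1`.
  have hpt : ∀ ξ : ℝ, ENNReal.ofReal (2 * z.re / (z.re ^ 2 + (2 * Real.pi * ξ - z.im) ^ 2)) *
      ‖u ξ‖ₑ ≤ ∑' i, ENNReal.ofReal (8 * (1 / 2) ^ i.1 / 2 ^ (l + i.1)) *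
        (D i).indicator (fun ξ => ‖u ξ‖ₑ) ξ := by
    intro ξ
    obtain ⟨n, hn1, hn2⟩ := exists_poisson_le (s := ξ - Y) h1 h2
    obtain ⟨σ, hσ⟩ := mem_dyadic_of_abs_sub_lt (by positivity) hn1
    refine le_trans ?_ (ENNReal.le_tsum (n, σ))
    rw [indicator_of_mem (by exact hσ)]
    refine mul_le_mul' (ENNReal.ofReal_le_ofReal ?_) le_rfl
    refine le_trans ?_ hn2
    have hpi := Real.pi_gt_three
    have e : 2 * z.re / (z.re ^ 2 + (2 * Real.pi * ξ - z.im) ^ 2) =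
        (1 / Real.pi) * (X / (X ^ 2 + (ξ - Y) ^ 2)) := by
      have e1 : z.re = 2 * Real.pi * X := by rw [hX]; field_simp
      have e2 : z.im = 2 * Real.pi * Y := by rw [hY]; field_simp
      have hX0 : 0 < X := by rw [hX]; positivity
      have e3 : X ^ 2 + (ξ - Y) ^ 2 ≠ 0 := by positivity
      have e4 : (2 * Real.pi * X) ^ 2 + (2 * Real.pi * ξ - 2 * Real.pi * Y) ^ 2 =
          4 * Real.pi ^ 2 * (X ^ 2 + (ξ - Y) ^ 2) := by ring
      rw [e1, e2, e4]
      field_simp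
      norm_num
    rw [e]
    have hX0 : 0 < X := by rw [hX]; positivity
    refine mul_le_of_le_one_left (by positivity) ?_
    rw [div_le_one Real.pi_pos]
    linarith
  refine (enorm_laplaceTransform_le hz h).trans ((lintegral_mono hpt).trans (le_of_eq ?_))
  have hmeas : AEMeasurable (fun ξ => ‖u ξ‖ₑ) volume := hum.1.enorm
  rw [lintegral_tsum fun i => (hmeas.indicator measurableSet_Ico).const_mul _]
  refine tsum_congr fun i => ?_
  have hpow : (0 : ℝ) < 2 ^ (l + i.1) := by positivity
  have hint : IntegrableOn u (D i) := by
    have : IsFiniteMeasure (volume.restrict (D i)) := ⟨by simp [hD]⟩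
    exact (hum.restrict (D i)).integrable one_le_two
  rw [lintegral_const_mul'' _ (hmeas.indicator measurableSet_Ico),
    lintegral_indicator measurableSet_Ico, ← ofReal_integral_norm_eq_lintegral_enorm hint,
    ← ENNReal.ofReal_mul (by positivity), ← ENNReal.ofReal_mul (by positivity), dyadicAverage]
  congr 1
  ring

lemma sum_ofReal_le_of_carleson {z : ℕ → ℂ} {m : ℕ → ℝ} {κ : ℝ} {I : Set ℝ}
    (hI : ∑' k : {k : ℕ // z k ∈ carlesonSquare I}, ENNReal.ofReal (m k) ≤
      ENNReal.ofReal κ * volume I) {S : Finset ℕ} (hS : ∀ k ∈ S, z k ∈ carlesonSquare I) :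
    ∑ k ∈ S, ENNReal.ofReal (m k) ≤ ENNReal.ofReal κ * volume I := by
  refine le_trans ?_ hI
  have h := tsum_subtype {k : ℕ | z k ∈ carlesonSquare I} fun k => ENNReal.ofReal (m k)
  refine le_trans ?_ h.symm.le
  refine le_trans (le_of_eq ?_) (ENNReal.sum_le_tsum S)
  refine Finset.sum_congr rfl fun k hk => ?_
  have hk' : k ∈ {k : ℕ | z k ∈ carlesonSquare I} := hS k hk
  rw [indicator_of_mem hk']

/-- The Carleson embedding theorem for Laplace transforms of `L²(0,∞)` functions. -/
theorem carleson_embedding {z : ℕ → ℂ} (hz : ∀ k, 0 < (z k).re) {m : ℕ → ℝ} (hm : ∀ k, 0 ≤ m k)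
    {κ : ℝ} (hκ : 0 < κ)
    (hC : ∀ I : Set ℝ, I.OrdConnected → ∑' k : {k : ℕ // z k ∈ carlesonSquare I},
      ENNReal.ofReal (m k) ≤ ENNReal.ofReal κ * volume I) (K : Finset ℕ) (h : L2Half) :
    ∑ k ∈ K, m k * ‖laplaceTransform h (z k)‖ ^ 2 ≤
      2 * 48 * 48 * (4 * (κ * (6 * Real.pi))) * ‖h‖ ^ 2 := by
  have hpi := Real.pi_pos
  have hlex : ∀ k, ∃ l : ℤ, 2 ^ l ≤ (z k).re / (2 * Real.pi) ∧
      (z k).re / (2 * Real.pi) < 2 ^ (l + 1) := fun k =>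
    exists_mem_Ico_zpow (div_pos (hz k) (by positivity)) one_lt_two
  choose l hl1 hl2 using hlex
  set w : ℕ × Fin 3 → ℝ≥0∞ := fun i => ENNReal.ofReal (8 * (1 / 2) ^ i.1) with hw
  set p : ℕ × Fin 3 → ℕ → ℝ := fun i k =>
    (z k).im / (2 * Real.pi) + ((i.2 : ℕ) - 1 : ℝ) * 2 ^ (l k + i.1) with hp
  set κ' := κ * (6 * Real.pi) with hκ'
  -- Three shifts times `8 ∑ 2^{-n} = 16`.
  have hwsum : ∑' i, w i = 48 := by
    rw [ENNReal.tsum_prod']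
    simp only [hw, tsum_fintype, Finset.sum_const, Finset.card_univ, Fintype.card_fin,
      nsmul_eq_mul]
    rw [ENNReal.tsum_mul_left, ← ENNReal.ofReal_tsum_of_nonneg (fun n => by positivity)
      (summable_geometric_two.mul_left 8), tsum_mul_left, tsum_geometric_two,
      ← ENNReal.ofReal_natCast, ← ENNReal.ofReal_mul (by positivity)]
    norm_num
  have hdy : ∀ i, ∑ k ∈ K, m k * dyadicAverage h (l k + i.1) (p i k) ^ 2 ≤ 4 * κ' * ‖h‖ ^ 2 := by
    intro i
    have hF : MemLp (fun ξ => ‖(𝓕 (zeroExtend h) : Lp ℂ 2 (volume : Measure ℝ)) ξ‖) 2 volume :=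
      (Lp.memLp _).norm
    have := dyadic_carleson_embedding hF K (fun k => l k + i.1) (p i) m hm
      (κ := κ') (by positivity) ?_
    · rw [integral_norm_sq_eq_norm_sq, Lp.norm_fourier_eq, norm_zeroExtend] at this
      exact this
    intro j a
    have hL : (0 : ℝ) < 2 ^ j := by positivity
    -- The dyadic interval with one neighbour on each side, to absorb the shift, scaled by `2π`. Its
    -- length `6π 2^j` exceeds the heights, which are below `2π 2^{l_k+1} ≤ 4π 2^j`.
    set I : Set ℝ := Ico (2 * Real.pi * ((a - 1) * 2 ^ j)) (2 * Real.pi * ((a + 2) * 2 ^ j)) with hI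
    have hvol : volume I = ENNReal.ofReal (6 * Real.pi * 2 ^ j) := by
      rw [hI, Real.volume_Ico]; congr 1; ring
    have hsub : ∀ k ∈ dyadicBelow K (fun k => l k + (i.1 : ℤ)) (p i) j a,
        z k ∈ carlesonSquare I := by
      intro k hk
      rw [dyadicBelow, Finset.mem_filter] at hk
      obtain ⟨-, hk1, hk2⟩ := hk
      have hle : (2 : ℝ) ^ (l k + (i.1 : ℤ)) ≤ 2 ^ j := zpow_le_zpow_right₀ one_le_two hk1
      have hpos : (0 : ℝ) < 2 ^ (l k + (i.1 : ℤ)) := by positivity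
      rw [Int.floor_eq_iff, le_div_iff₀ hL, div_lt_iff₀ hL] at hk2
      have hσ1 : (-1 : ℝ) ≤ ((i.2 : ℕ) - 1 : ℝ) := by
        linarith [(Nat.cast_nonneg (i.2 : ℕ) : (0 : ℝ) ≤ (i.2 : ℕ))]
      have hσ2 : ((i.2 : ℕ) - 1 : ℝ) ≤ 1 := by
        have : ((i.2 : ℕ) : ℝ) ≤ (2 : ℕ) := by exact_mod_cast Nat.lt_succ_iff.1 i.2.2
        push_cast at this
        linarith
      have hs1 : -2 ^ j ≤ ((i.2 : ℕ) - 1 : ℝ) * 2 ^ (l k + (i.1 : ℤ)) := by nlinarith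
      have hs2 : ((i.2 : ℕ) - 1 : ℝ) * 2 ^ (l k + (i.1 : ℤ)) ≤ 2 ^ j := by nlinarith
      have him : (z k).im = 2 * Real.pi * ((z k).im / (2 * Real.pi)) := by field_simp
      have hre : (z k).re = 2 * Real.pi * ((z k).re / (2 * Real.pi)) := by field_simp
      simp only [hp] at hk2
      refine ⟨⟨?_, ?_⟩, hz k, ?_⟩
      · rw [him]
        refine mul_le_mul_of_nonneg_left ?_ (by positivity)
        linarith [hk2.1]
      · rw [him]
        refine mul_lt_mul_of_pos_left ?_ (by positivity)
        linarith [hk2.2]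
      · rw [hvol, ENNReal.ofReal_lt_ofReal_iff (by positivity), hre]
        have h3 : (2 : ℝ) ^ (l k + 1) ≤ 2 * 2 ^ j := by
          rw [mul_comm, ← zpow_add_one₀ two_ne_zero]
          exact zpow_le_zpow_right₀ one_le_two (by omega)
        have h4 := (hl2 k).trans_le h3
        nlinarith [mul_lt_mul_of_pos_left h4 hpi]
    have hsum := sum_ofReal_le_of_carleson (hC I ordConnected_Ico) hsub
    rw [hvol, ← ENNReal.ofReal_mul hκ.le, ← ENNReal.ofReal_sum_of_nonneg fun k _ => hm k,
      ENNReal.ofReal_le_ofReal_iff (by positivity)] at hsum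
    rw [hκ']
    linarith
  -- After weighted Cauchy–Schwarz the sums are interchanged, and each pair of scale and shift is a
  -- separate dyadic embedding with the same constant.
  have hmain : ∑ k ∈ K, ENNReal.ofReal (m k) * ‖laplaceTransform h (z k)‖ₑ ^ 2 ≤
      2 * 48 * 48 * ENNReal.ofReal (4 * κ' * ‖h‖ ^ 2) := by
    calc ∑ k ∈ K, ENNReal.ofReal (m k) * ‖laplaceTransform h (z k)‖ₑ ^ 2
        ≤ ∑ k ∈ K, ENNReal.ofReal (m k) * (2 * 48 * ∑' i, w i *
            ENNReal.ofReal (dyadicAverage h (l k + i.1) (p i k)) ^ 2) := by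
          refine Finset.sum_le_sum fun k _ => ?_
          gcongr
          refine (pow_le_pow_left' (enorm_laplaceTransform_le_tsum (hz k) h (hl1 k) (hl2 k)) 2).trans ?_
          rw [← hwsum]
          exact ENNReal.tsum_mul_sq_le _ _
      _ = 2 * 48 * ∑' i, w i * ∑ k ∈ K, ENNReal.ofReal (m k) *
            ENNReal.ofReal (dyadicAverage h (l k + i.1) (p i k)) ^ 2 := by
          simp_rw [mul_left_comm _ (2 * 48 : ℝ≥0∞), ← ENNReal.tsum_mul_left, Finset.mul_sum]
          rw [← Summable.tsum_finsetSum fun _ _ => ENNReal.summable]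
          refine tsum_congr fun i => Finset.sum_congr rfl fun k _ => ?_
          ring
      _ ≤ 2 * 48 * ∑' i, w i * ENNReal.ofReal (4 * κ' * ‖h‖ ^ 2) := by
          gcongr with i
          refine le_trans (le_of_eq ?_) (ENNReal.ofReal_le_ofReal (hdy i))
          rw [ENNReal.ofReal_sum_of_nonneg fun k _ => mul_nonneg (hm k) (sq_nonneg _)]
          refine Finset.sum_congr rfl fun k _ => ?_
          rw [ENNReal.ofReal_mul (hm k), ENNReal.ofReal_pow]
          exact div_nonneg (integral_nonneg fun t => norm_nonneg _) (by positivity)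
      _ = 2 * 48 * 48 * ENNReal.ofReal (4 * κ' * ‖h‖ ^ 2) := by
          rw [ENNReal.tsum_mul_right, hwsum]; ring
  have e1 : ∑ k ∈ K, ENNReal.ofReal (m k) * ‖laplaceTransform h (z k)‖ₑ ^ 2 =
      ENNReal.ofReal (∑ k ∈ K, m k * ‖laplaceTransform h (z k)‖ ^ 2) := by
    rw [ENNReal.ofReal_sum_of_nonneg fun k _ => mul_nonneg (hm k) (sq_nonneg _)]
    refine Finset.sum_congr rfl fun k _ => ?_
    rw [ENNReal.ofReal_mul (hm k), ENNReal.ofReal_pow (norm_nonneg _), ofReal_norm]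
  have e2 : (2 * 48 * 48 : ℝ≥0∞) = ENNReal.ofReal (2 * 48 * 48) := by
    norm_num
  rw [e1, e2, ← ENNReal.ofReal_mul (by norm_num), ENNReal.ofReal_le_ofReal_iff (by positivity)]
    at hmain
  linarith

end Embedding

/-! ### Infinite Blaschke products -/

section BlaschkeProduct

lemma pseudoHyp_nonneg (z w : ℂ) : 0 ≤ pseudoHyp z w := norm_nonneg _

lemma pseudoHyp_le_one {z w : ℂ} (hz : 0 < z.re) (hw : 0 < w.re) : pseudoHyp z w ≤ 1 := by
  rw [pseudoHyp, norm_div]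
  refine div_le_one_of_le₀ ?_ (norm_nonneg _)
  rw [← sq_le_sq₀ (norm_nonneg _) (norm_nonneg _), ← Complex.normSq_eq_norm_sq,
    ← Complex.normSq_eq_norm_sq, Complex.normSq_apply, Complex.normSq_apply]
  simp only [Complex.sub_re, Complex.sub_im, Complex.add_re, Complex.add_im, Complex.conj_re,
    Complex.conj_im]
  nlinarith [mul_pos hz hw]

lemma antitone_prod_pseudoHyp {z : ℕ → ℂ} (hz : ∀ k, 0 < (z k).re) (k : ℕ) :
    Antitone fun s : Finset {j : ℕ // j ≠ k} => ∏ j ∈ s, pseudoHyp (z j) (z k) := fun s t hst =>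
  by
  classical
  simp only
  rw [← Finset.prod_sdiff hst]
  exact mul_le_of_le_one_left (Finset.prod_nonneg fun j _ => pseudoHyp_nonneg _ _)
    (Finset.prod_le_one (fun j _ => pseudoHyp_nonneg _ _)
      fun j _ => pseudoHyp_le_one (hz _) (hz _))

/-- The factors lie in `[0,1]`, so finite products decrease as the index set grows and converge to
their infimum, possibly `0`. -/
lemma hasProd_blaschkeB {z : ℕ → ℂ} (hz : ∀ k, 0 < (z k).re) (k : ℕ) :
    HasProd (fun j : {j : ℕ // j ≠ k} => pseudoHyp (z j) (z k)) (blaschkeB z k) := by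
  have h : HasProd (fun j : {j : ℕ // j ≠ k} => pseudoHyp (z j) (z k))
      (⨅ s : Finset {j : ℕ // j ≠ k}, ∏ j ∈ s, pseudoHyp (z j) (z k)) := by
    rw [HasProd, SummationFilter.unconditional_filter]
    refine tendsto_atTop_ciInf (antitone_prod_pseudoHyp hz k) ⟨0, ?_⟩
    rintro _ ⟨s, rfl⟩
    exact Finset.prod_nonneg fun j _ => pseudoHyp_nonneg _ _
  exact h.multipliable.hasProd

lemma prod_subtype_ne_pseudoHyp (z : ℕ → ℂ) (k : ℕ) (s : Finset ℕ) :
    ∏ j ∈ s.subtype (· ≠ k), pseudoHyp (z j) (z k) = ∏ j ∈ s.erase k, pseudoHyp (z j) (z k) := by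
  rw [Finset.prod_subtype_eq_prod_filter (f := fun j => pseudoHyp (z j) (z k)), Finset.filter_ne']

lemma tendsto_norm_finiteBlaschke {z : ℕ → ℂ} (hz : ∀ k, 0 < (z k).re) (k : ℕ) :
    Filter.Tendsto (fun n => ‖finiteBlaschke (Finset.range n) z k‖) Filter.atTop
      (nhds (blaschkeB z k)) := by
  have h := hasProd_blaschkeB hz k
  rw [HasProd, SummationFilter.unconditional_filter] at h
  have h2 : Filter.Tendsto (fun n => (Finset.range n).subtype (· ≠ k)) Filter.atTop
      Filter.atTop := by
    refine Filter.tendsto_atTop_finset_of_monotone (fun a b hab => ?_) fun x => ⟨x + 1, by simp⟩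
    exact Finset.subtype_mono (Finset.range_mono hab)
  refine (h.comp h2).congr fun n => ?_
  rw [norm_finiteBlaschke, Function.comp_apply, prod_subtype_ne_pseudoHyp]

lemma blaschkeB_le_norm_finiteBlaschke {z : ℕ → ℂ} (hz : ∀ k, 0 < (z k).re) (k : ℕ)
    (s : Finset ℕ) : blaschkeB z k ≤ ‖finiteBlaschke s z k‖ := by
  have h := hasProd_blaschkeB hz k
  rw [HasProd, SummationFilter.unconditional_filter] at h
  rw [norm_finiteBlaschke, ← prod_subtype_ne_pseudoHyp]
  exact (antitone_prod_pseudoHyp hz k).le_of_tendsto h _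

lemma blaschkeB_nonneg {z : ℕ → ℂ} (hz : ∀ k, 0 < (z k).re) (k : ℕ) : 0 ≤ blaschkeB z k :=
  ge_of_tendsto' (tendsto_norm_finiteBlaschke hz k) fun _ => norm_nonneg _

lemma injective_of_blaschkeB_pos {z : ℕ → ℂ} (hz : ∀ k, 0 < (z k).re)
    (hb : ∀ k, 0 < blaschkeB z k) : Function.Injective z := by
  intro j k hjk
  by_contra hne
  have h := blaschkeB_le_norm_finiteBlaschke hz k {j}
  rw [norm_finiteBlaschke, Finset.prod_eq_zero (i := j)] at h
  · exact (hb k).not_ge h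
  · simp [hne]
  · simp [pseudoHyp, hjk]

end BlaschkeProduct

/-! ### Reduction of the weights -/

section Weights

variable {β : ℝ} {g z : ℕ → ℂ}

/-- The weights `g_k (1 + z_k)^{-β}` of the equivalent interpolation problem in `L²(0,∞)`. -/
def shiftedWeight (β : ℝ) (g z : ℕ → ℂ) (k : ℕ) : ℂ := g k * (1 + z k) ^ (-(β : ℂ))

lemma one_add_ne_zero_of_re_pos {w : ℂ} (hw : 0 < w.re) : 1 + w ≠ 0 := fun h => by
  have := congrArg Complex.re h
  simp at this
  linarith

lemma norm_shiftedWeight (β : ℝ) (g z : ℕ → ℂ) (k : ℕ) :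
    ‖shiftedWeight β g z k‖ = ‖g k‖ * ‖1 + z k‖ ^ (-β) := by
  rw [shiftedWeight, norm_mul, ← Complex.ofReal_neg, Complex.norm_cpow_real]

lemma shiftedWeight_ne_zero (hg : ∀ k, g k ≠ 0) (hz : ∀ k, 0 < (z k).re) (k : ℕ) :
    shiftedWeight β g z k ≠ 0 := by
  rw [← norm_pos_iff, norm_shiftedWeight]
  have := norm_pos_iff.2 (hg k)
  have := norm_pos_iff.2 (one_add_ne_zero_of_re_pos (hz k))
  positivity

/-- The factor `|1 + z_k|^{2β} / |g_k|²` is `|G_k|^{-2}` for the shifted weight `G_k`. A vanishing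
Blaschke product is treated apart, since both quotients are then `∞`. -/
lemma carlesonWeight_eq (hg : ∀ k, g k ≠ 0) (hz : ∀ k, 0 < (z k).re) (k : ℕ) :
    carlesonWeight β g z k =
      ENNReal.ofReal ((2 * (z k).re / ‖shiftedWeight β g z k‖) ^ 2) /
        ENNReal.ofReal (blaschkeB z k ^ 2) := by
  have h1 : 0 < ‖1 + z k‖ := norm_pos_iff.2 (one_add_ne_zero_of_re_pos (hz k))
  have h2 : 0 < ‖g k‖ := norm_pos_iff.2 (hg k)
  have h3 := hz k
  have h4 : 0 < ‖shiftedWeight β g z k‖ := norm_pos_iff.2 (shiftedWeight_ne_zero hg hz k)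
  rw [carlesonWeight]
  rcases eq_or_ne (blaschkeB z k) 0 with hb | hb
  · have e1 : |2 * (z k).re| ^ 2 * ‖1 + z k‖ ^ (2 * β) > 0 := by positivity
    have e2 : (2 * (z k).re / ‖shiftedWeight β g z k‖) ^ 2 > 0 := by positivity
    simp only [hb, abs_zero, ne_eq, OfNat.ofNat_ne_zero, not_false_eq_true, zero_pow, zero_mul,
      ENNReal.ofReal_zero]
    rw [ENNReal.div_zero (ENNReal.ofReal_pos.2 e1).ne', ENNReal.div_zero (ENNReal.ofReal_pos.2 e2).ne']
  · rw [← ENNReal.ofReal_div_of_pos (by positivity), ← ENNReal.ofReal_div_of_pos (by positivity)]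
    congr 1
    rw [norm_shiftedWeight, sq_abs, sq_abs, Real.rpow_neg h1.le, mul_comm 2 β,
      Real.rpow_mul h1.le, Real.rpow_two]
    field_simp

end Weights

/-! ### From the Carleson condition to interpolation -/

section Sufficiency

variable {β : ℝ} {g z : ℕ → ℂ}

/-- Expanding only one side of `⟨T, T⟩` leaves the values of `T` at the nodes, so that the embedding
can be applied to `T` itself. -/
lemma norm_sq_le_sum_of_inner {H : Type*} [NormedAddCommGroup H] [InnerProductSpace ℂ H]
    (e : ℕ → H) (c : ℕ → ℂ) (s : Finset ℕ) :
    ‖∑ j ∈ s, conj (c j) • e j‖ ^ 2 ≤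
      ∑ j ∈ s, ‖c j‖ * ‖(inner ℂ (e j) (∑ j ∈ s, conj (c j) • e j) : ℂ)‖ := by
  set T := ∑ j ∈ s, conj (c j) • e j with hT
  have h1 : inner ℂ T T = ∑ j ∈ s, c j * inner ℂ (e j) T := by
    conv_lhs => rw [hT, sum_inner]
    simp_rw [inner_smul_left, Complex.conj_conj]
    rfl
  calc ‖T‖ ^ 2 = ‖(inner ℂ T T : ℂ)‖ := by rw [inner_self_eq_norm_sq_to_K]; simp
    _ ≤ _ := by
      rw [h1]
      refine (norm_sum_le _ _).trans (le_of_eq ?_)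
      simp_rw [norm_mul]

lemma sum_norm_sq_le_norm_sq (a : lp (fun _ : ℕ => ℂ) 2) (s : Finset ℕ) :
    ∑ j ∈ s, ‖a j‖ ^ 2 ≤ ‖a‖ ^ 2 := by
  have h := lp.sum_rpow_le_norm_rpow (p := 2) (by norm_num) a s
  simpa using h

/-- If the Carleson condition holds, the weighted interpolation problem in `L²(0,∞)` is solvable with a
uniform bound. -/
theorem exists_interpolant_of_carleson (hg : ∀ k, g k ≠ 0) (hz : ∀ k, 0 < (z k).re)
    {κ : ℝ≥0} (hκ : 0 < κ) (hC : ∀ I : Set ℝ, I.OrdConnected →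
      ∑' k : {k : ℕ // z k ∈ carlesonSquare I}, carlesonWeight β g z k ≤ κ * volume I) :
    ∃ M : ℝ, ∀ a : lp (fun _ : ℕ => ℂ) 2, ‖a‖ = 1 → ∃ F : L2Half, ‖F‖ ≤ M ∧
      ∀ k, shiftedWeight β g z k * laplaceTransform F (z k) = a k := by
  have hb : ∀ k, 0 < blaschkeB z k := by
    intro k
    refine lt_of_le_of_ne (blaschkeB_nonneg hz k) fun hb => ?_
    have h1 := hz k
    -- A single square of finite width `2 Re z_k` containing `z_k` already forces its weight to be
    -- finite.
    have hmem : z k ∈ carlesonSquare (Icc ((z k).im - (z k).re) ((z k).im + (z k).re)) := by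
      refine ⟨⟨by linarith, by linarith⟩, h1, ?_⟩
      rw [Real.volume_Icc, ENNReal.ofReal_lt_ofReal_iff] <;> linarith
    have h2 := (ENNReal.le_tsum (⟨k, hmem⟩ : {j : ℕ // z j ∈ carlesonSquare
      (Icc ((z k).im - (z k).re) ((z k).im + (z k).re))}) (f := fun j : {j : ℕ // z j ∈ carlesonSquare
      (Icc ((z k).im - (z k).re) ((z k).im + (z k).re))} => carlesonWeight β g z j)).trans (hC _ ordConnected_Icc)
    have h3 : carlesonWeight β g z k = ∞ := by
      rw [carlesonWeight_eq hg hz, ← hb, zero_pow two_ne_zero, ENNReal.ofReal_zero,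
        ENNReal.div_zero]
      have h4 : 0 < ‖shiftedWeight β g z k‖ := norm_pos_iff.2 (shiftedWeight_ne_zero hg hz k)
      exact (ENNReal.ofReal_pos.2 (by positivity)).ne'
    simp only [h3] at h2
    rw [top_le_iff, Real.volume_Icc] at h2
    exact ENNReal.mul_ne_top ENNReal.coe_ne_top ENNReal.ofReal_ne_top h2
  have hinj := injective_of_blaschkeB_pos hz hb
  have hG : ∀ k, 0 < ‖shiftedWeight β g z k‖ := fun k =>
    norm_pos_iff.2 (shiftedWeight_ne_zero hg hz k)
  set r : ℕ → ℝ := fun k => 2 * (z k).re / ‖shiftedWeight β g z k‖ / blaschkeB z k with hr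
  have hweight : ∀ k, carlesonWeight β g z k = ENNReal.ofReal (r k ^ 2) := by
    intro k
    have := hb k
    rw [carlesonWeight_eq hg hz, ← ENNReal.ofReal_div_of_pos (by positivity), ← div_pow]
  have hκ' : (0 : ℝ) < κ := hκ
  have hemb := carleson_embedding hz (m := fun k => r k ^ 2) (fun k => sq_nonneg _) hκ'
    (fun I hI => by simpa [hweight] using hC I hI)
  set C : ℝ := 2 * 48 * 48 * (4 * ((κ : ℝ) * (6 * Real.pi))) with hCdef
  have hC0 : 0 ≤ C := by have := Real.pi_pos; positivity
  refine ⟨Real.sqrt C, fun a ha => ?_⟩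
  set e : ℕ → L2Half := fun k => laplaceKernel (z k) (hz k) with he
  have hgram : ∀ i j, inner ℂ (e i) (e j) = 1 / (z i + conj (z j)) := fun i j => by
    rw [he, inner_laplaceKernel, laplaceTransform_laplaceKernel (hz i) (hz j)]
  obtain ⟨F, hF, hFk⟩ := exists_forall_inner_eq_of_forall_lt e
    (fun k => a k / shiftedWeight β g z k) (Real.sqrt C) (fun n => by
      obtain ⟨F, -, hF1, hF2⟩ := exists_interpolant_mem_span (s := Finset.range n) hz
        hinj.injOn hgram (fun k => a k / shiftedWeight β g z k)
      refine ⟨F, ?_, fun k hk => hF1 k (Finset.mem_range.2 hk)⟩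
      rw [hF2]
      set c : ℕ → ℂ := fun j => 2 * (z j).re * (a j / shiftedWeight β g z j) /
        finiteBlaschke (Finset.range n) z j with hc
      set T := ∑ j ∈ Finset.range n, conj (c j) • e j with hT
      -- Truncation only enlarges the Blaschke product, so this bound is uniform in `n`.
      have hcle : ∀ j, ‖c j‖ ≤ ‖a j‖ * r j := by
        intro j
        have h1 := hz j
        have h2 := hb j
        have h3 := hG j
        have h4 := blaschkeB_le_norm_finiteBlaschke hz j (Finset.range n)
        have : ‖c j‖ = ‖a j‖ * (2 * (z j).re / ‖shiftedWeight β g z j‖ /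
            ‖finiteBlaschke (Finset.range n) z j‖) := by
          simp only [hc, norm_div, norm_mul, Complex.norm_ofNat, Complex.norm_of_nonneg h1.le]
          ring
        rw [this]
        refine mul_le_mul_of_nonneg_left ?_ (norm_nonneg _)
        exact div_le_div_of_nonneg_left (by positivity) h2 h4
      have h1 : ‖T‖ ^ 2 ≤ ∑ j ∈ Finset.range n, ‖a j‖ * (r j * ‖laplaceTransform T (z j)‖) := by
        refine (norm_sq_le_sum_of_inner e c _).trans (Finset.sum_le_sum fun j _ => ?_)
        rw [← hT, he, inner_laplaceKernel, ← mul_assoc]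
        exact mul_le_mul_of_nonneg_right (hcle j) (norm_nonneg _)
      -- Cauchy–Schwarz in `j` followed by the embedding for `T`; cancelling `‖T‖²` leaves `‖T‖² ≤
      -- C`.
      have h2 : (‖T‖ ^ 2) ^ 2 ≤ C * ‖T‖ ^ 2 := by
        calc (‖T‖ ^ 2) ^ 2 ≤
            (∑ j ∈ Finset.range n, ‖a j‖ * (r j * ‖laplaceTransform T (z j)‖)) ^ 2 := by gcongr
          _ ≤ (∑ j ∈ Finset.range n, ‖a j‖ ^ 2) *
              ∑ j ∈ Finset.range n, (r j * ‖laplaceTransform T (z j)‖) ^ 2 :=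
            Finset.sum_mul_sq_le_sq_mul_sq _ _ _
          _ ≤ 1 * (C * ‖T‖ ^ 2) := by
            refine mul_le_mul ?_ ?_ (Finset.sum_nonneg fun _ _ => sq_nonneg _) zero_le_one
            · simpa [ha] using sum_norm_sq_le_norm_sq a (Finset.range n)
            · simpa [mul_pow] using hemb (Finset.range n) T
          _ = _ := one_mul _
      refine Real.le_sqrt_of_sq_le ?_
      rcases eq_or_ne (‖T‖ ^ 2) 0 with h0 | h0
      · rw [h0]; exact hC0
      · rw [sq (‖T‖ ^ 2)] at h2
        exact le_of_mul_le_mul_right h2 (lt_of_le_of_ne (sq_nonneg _) h0.symm))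
  refine ⟨F, hF, fun k => ?_⟩
  have := hFk k
  simp only [he, inner_laplaceKernel] at this
  rw [this, mul_div_cancel₀ _ (shiftedWeight_ne_zero hg hz k)]

end Sufficiency

/-! ### From interpolation to the Carleson condition -/

section Necessity

variable {G z : ℕ → ℂ} {M : ℝ}

/-- Solvability of the interpolation problem for unit vectors gives it for finitely many arbitrary
values, with the norm controlled. -/
lemma exists_interpolant_range (h : ∀ a : lp (fun _ : ℕ => ℂ) 2, ‖a‖ = 1 → ∃ F : L2Half, ‖F‖ ≤ M ∧
      ∀ k, G k * laplaceTransform F (z k) = a k) (hz : ∀ k, 0 < (z k).re) (n : ℕ) (v : ℕ → ℂ) :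
    ∃ F : L2Half, ‖F‖ ≤ M * Real.sqrt (∑ j ∈ Finset.range n, ‖v j‖ ^ 2) ∧
      ∀ k ∈ Finset.range n, G k * laplaceTransform F (z k) = v k := by
  set b : lp (fun _ : ℕ => ℂ) 2 := ∑ j ∈ Finset.range n, lp.single 2 j (v j) with hb
  have hbn : ‖b‖ ^ 2 = ∑ j ∈ Finset.range n, ‖v j‖ ^ 2 := by
    have := lp.norm_sum_single (p := 2) (by norm_num) v (Finset.range n)
    simpa using this
  have hbk : ∀ k ∈ Finset.range n, b k = v k := by
    intro k hk
    rw [hb, lp.coeFn_sum, Finset.sum_apply]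
    simp only [lp.coeFn_single, Pi.single_apply]
    rw [Finset.sum_ite_eq]
    simp [Finset.mem_range.1 hk]
  have hsq : Real.sqrt (∑ j ∈ Finset.range n, ‖v j‖ ^ 2) = ‖b‖ := by
    rw [← hbn, Real.sqrt_sq (norm_nonneg _)]
  rw [hsq]
  rcases eq_or_ne b 0 with h0 | h0
  · refine ⟨0, by simp [h0], fun k hk => ?_⟩
    rw [← hbk k hk, h0, ← inner_laplaceKernel (hz k)]
    simp
  · have hn : ‖b‖ ≠ 0 := norm_ne_zero_iff.2 h0
    obtain ⟨F, hF, hFk⟩ := h (((‖b‖⁻¹ : ℝ) : ℂ) • b) (by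
      rw [norm_smul, Complex.norm_of_nonneg (by positivity), inv_mul_cancel₀ hn])
    refine ⟨((‖b‖ : ℝ) : ℂ) • F, ?_, fun k hk => ?_⟩
    · rw [norm_smul, Complex.norm_of_nonneg (norm_nonneg _), mul_comm]
      gcongr
    · have h1 := hFk k
      rw [← inner_laplaceKernel (hz k)] at h1 ⊢
      rw [inner_smul_right, mul_left_comm, h1, lp.coeFn_smul, Pi.smul_apply, smul_eq_mul,
        ← mul_assoc, ← Complex.ofReal_mul, mul_inv_cancel₀ hn, Complex.ofReal_one, one_mul,
        hbk k hk]

lemma injective_of_interpolation (h : ∀ a : lp (fun _ : ℕ => ℂ) 2, ‖a‖ = 1 → ∃ F : L2Half, ‖F‖ ≤ M ∧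
      ∀ k, G k * laplaceTransform F (z k) = a k) (hG : ∀ k, G k ≠ 0) : Function.Injective z := by
  intro j k hjk
  by_contra hne
  obtain ⟨F, -, hF⟩ := h (lp.single 2 j 1) (by rw [lp.norm_single (by norm_num)]; simp)
  have h1 := hF j
  have h2 := hF k
  simp only [lp.coeFn_single, Pi.single_eq_same, Pi.single_eq_of_ne (Ne.symm hne)] at h1 h2
  rw [← hjk] at h2
  rcases mul_eq_zero.1 h2 with h3 | h3
  · exact hG k h3
  · rw [h3, mul_zero] at h1
    exact zero_ne_one h1

/-- Solvability of the interpolation problem implies a finite Carleson embedding. -/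
theorem sum_norm_sq_le_of_interpolation
    (h : ∀ a : lp (fun _ : ℕ => ℂ) 2, ‖a‖ = 1 → ∃ F : L2Half, ‖F‖ ≤ M ∧
      ∀ k, G k * laplaceTransform F (z k) = a k) (hG : ∀ k, G k ≠ 0) (hz : ∀ k, 0 < (z k).re)
    (hM : 0 ≤ M) (n : ℕ) (f : L2Half) :
    ∑ j ∈ Finset.range n, (2 * (z j).re / ‖G j‖ / ‖finiteBlaschke (Finset.range n) z j‖) ^ 2 *
      ‖laplaceTransform f (z j)‖ ^ 2 ≤ M ^ 2 * ‖f‖ ^ 2 := by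
  have hinj := injective_of_interpolation h hG
  set s := Finset.range n with hs
  set e : ℕ → L2Half := fun k => laplaceKernel (z k) (hz k) with he
  have hgram : ∀ i j, inner ℂ (e i) (e j) = 1 / (z i + conj (z j)) := fun i j => by
    rw [he, inner_laplaceKernel, laplaceTransform_laplaceKernel (hz i) (hz j)]
  set d : ℕ → ℂ := fun j => 2 * (z j).re / G j / finiteBlaschke s z j with hd
  -- The data are chosen by duality: the companion sum of the minimal interpolant of `v / G` pairs
  -- with `f` to exactly `∑ |v_j|²`.
  set v : ℕ → ℂ := fun j => conj (d j * laplaceTransform f (z j)) with hv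
  set S := ∑ j ∈ s, ‖v j‖ ^ 2 with hS
  have hS0 : 0 ≤ S := Finset.sum_nonneg fun _ _ => sq_nonneg _
  have hSeq : ∑ j ∈ s, (2 * (z j).re / ‖G j‖ / ‖finiteBlaschke s z j‖) ^ 2 *
      ‖laplaceTransform f (z j)‖ ^ 2 = S := by
    refine Finset.sum_congr rfl fun j _ => ?_
    simp only [hv, hd, RCLike.norm_conj, norm_mul, norm_div, Complex.norm_ofNat,
      Complex.norm_of_nonneg (hz j).le, mul_pow]
  rw [hSeq]
  obtain ⟨F', hF', hF'k⟩ := exists_interpolant_range h hz n v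
  obtain ⟨F, hFs, hF1, hF2⟩ := exists_interpolant_mem_span (s := s) hz hinj.injOn hgram
    (fun k => v k / G k)
  -- The interpolant in the span has least norm, so it inherits the bound of the one provided by
  -- hypothesis.
  have hle : ‖F‖ ≤ M * Real.sqrt S := by
    refine (norm_le_of_mem_span_of_inner_eq hFs fun i hi => ?_).trans hF'
    rw [hF1 i hi, he, inner_laplaceKernel, ← hF'k i hi, mul_div_cancel_left₀ _ (hG i)]
  rw [hF2] at hle
  have hin : inner ℂ (∑ j ∈ s, conj (2 * (z j).re * (v j / G j) / finiteBlaschke s z j) • e j) f =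
      (S : ℂ) := by
    rw [sum_inner, hS]
    push_cast
    refine Finset.sum_congr rfl fun j _ => ?_
    rw [inner_smul_left, Complex.conj_conj, he, inner_laplaceKernel, ← Complex.conj_mul']
    simp only [hv, hd, Complex.conj_conj]
    ring
  have h1 : S ≤ M * Real.sqrt S * ‖f‖ := by
    calc S = ‖(S : ℂ)‖ := (Complex.norm_of_nonneg hS0).symm
      _ ≤ _ := by
        rw [← hin]
        exact (norm_inner_le_norm _ _).trans (mul_le_mul_of_nonneg_right hle (norm_nonneg _))
  have h2 : Real.sqrt S ≤ M * ‖f‖ := by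
    rcases (Real.sqrt_nonneg S).eq_or_lt with h0 | h0
    · rw [← h0]; positivity
    · refine le_of_mul_le_mul_right ?_ h0
      calc Real.sqrt S * Real.sqrt S = S := Real.mul_self_sqrt hS0
        _ ≤ _ := h1
        _ = _ := by ring
  calc S = Real.sqrt S ^ 2 := (Real.sq_sqrt hS0).symm
    _ ≤ (M * ‖f‖) ^ 2 := by gcongr
    _ = _ := mul_pow _ _ _

/-- The embedding tested on a Laplace kernel gives the Carleson condition. -/
theorem sum_le_of_interpolation
    (h : ∀ a : lp (fun _ : ℕ => ℂ) 2, ‖a‖ = 1 → ∃ F : L2Half, ‖F‖ ≤ M ∧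
      ∀ k, G k * laplaceTransform F (z k) = a k) (hG : ∀ k, G k ≠ 0) (hz : ∀ k, 0 < (z k).re)
    (hM : 0 ≤ M) {V c : ℝ} (hV : 0 < V) {K : Finset ℕ}
    (hK : ∀ k ∈ K, (z k).re ≤ V ∧ |(z k).im - c| ≤ V) {n : ℕ} (hn : K ⊆ Finset.range n) :
    ∑ j ∈ K, (2 * (z j).re / ‖G j‖ / ‖finiteBlaschke (Finset.range n) z j‖) ^ 2 ≤
      3 * M ^ 2 * V := by
  -- The test kernel sits at height `V` over the square: there `|z_k + conj w|² ≤ (2V)² + V² = 5V²`,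
  -- and the kernel has squared norm `1/(2V)`. The quotient gives `5/2`, rounded up to `3`.
  set w : ℂ := ⟨V, c⟩ with hw
  have hwre : 0 < w.re := hV
  have h1 := sum_norm_sq_le_of_interpolation h hG hz hM n (laplaceKernel w hwre)
  have h2 : ∀ k ∈ K, 1 / (5 * V ^ 2) ≤ ‖laplaceTransform (laplaceKernel w hwre) (z k)‖ ^ 2 := by
    intro k hk
    obtain ⟨a1, a2⟩ := hK k hk
    have a3 := hz k
    rw [laplaceTransform_laplaceKernel (hz k) hwre, norm_div, norm_one, div_pow, one_pow]
    have hne := norm_pos_iff.2 (add_conj_ne_zero_of_re_pos (hz k) hwre)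
    refine one_div_le_one_div_of_le (by positivity) ?_
    rw [← Complex.normSq_eq_norm_sq, Complex.normSq_apply]
    simp only [hw, Complex.add_re, Complex.add_im, Complex.conj_re, Complex.conj_im]
    have a4 := sq_le_sq' (by linarith [(abs_le.1 a2).1]) (abs_le.1 a2).2
    nlinarith
  have h3 : (∑ j ∈ K, (2 * (z j).re / ‖G j‖ / ‖finiteBlaschke (Finset.range n) z j‖) ^ 2) *
      (1 / (5 * V ^ 2)) ≤ M ^ 2 * (1 / (2 * V)) := by
    have h4 : ‖laplaceKernel w hwre‖ ^ 2 = 1 / (2 * V) := norm_sq_laplaceKernel hwre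
    rw [← h4]
    refine le_trans ?_ h1
    rw [Finset.sum_mul]
    refine (Finset.sum_le_sum fun j hj => mul_le_mul_of_nonneg_left (h2 j hj) (sq_nonneg _)).trans ?_
    exact Finset.sum_le_sum_of_subset_of_nonneg hn fun _ _ _ => by positivity
  rw [mul_one_div, div_le_iff₀ (by positivity)] at h3
  refine h3.trans ?_
  have : M ^ 2 * (1 / (2 * V)) * (5 * V ^ 2) = 5 / 2 * (M ^ 2 * V) := by field_simp
  rw [this]
  nlinarith [mul_nonneg (sq_nonneg M) hV.le]

end Necessity

/-! ### Conclusion -/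

/-- The Carleson condition follows from the solvability of the interpolation problem. -/
theorem carleson_of_interpolation {β : ℝ} {g z : ℕ → ℂ} (hg : ∀ k, g k ≠ 0)
    (hz : ∀ k, 0 < (z k).re) {M : ℝ} (hM : 0 < M)
    (h : ∀ a : lp (fun _ : ℕ => ℂ) 2, ‖a‖ = 1 → ∃ F : L2Half, ‖F‖ ≤ M ∧
      ∀ k, shiftedWeight β g z k * laplaceTransform F (z k) = a k) (I : Set ℝ)
    (hI : I.OrdConnected) :
    ∑' k : {k : ℕ // z k ∈ carlesonSquare I}, carlesonWeight β g z k ≤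
      ENNReal.ofReal (3 * M ^ 2) * volume I := by
  have hG := shiftedWeight_ne_zero (β := β) hg hz
  rcases eq_or_ne (volume I) ∞ with htop | htop
  · rw [htop, ENNReal.mul_top (ENNReal.ofReal_pos.2 (by positivity)).ne']
    exact le_top
  rw [ENNReal.tsum_eq_iSup_sum]
  refine iSup_le fun s => ?_
  rcases s.eq_empty_or_nonempty with rfl | ⟨k₀, hk₀⟩
  · simp
  set V := (volume I).toReal with hV
  have hIV : volume I = ENNReal.ofReal V := (ENNReal.ofReal_toReal htop).symm
  have hV0 : 0 < V := by
    have h1 := (k₀.2.2.2).trans_le' zero_le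
    exact ENNReal.toReal_pos h1.ne' htop
  set K : Finset ℕ := s.map (Function.Embedding.subtype _) with hK
  -- The imaginary part of any one point of the square serves as centre, since two points of `I` are
  -- at most `|I|` apart.
  have hKmem : ∀ k ∈ K, (z k).re ≤ V ∧ |(z k).im - (z k₀).im| ≤ V := by
    intro k hk
    simp only [hK, Finset.mem_map, Function.Embedding.coe_subtype] at hk
    obtain ⟨k, -, rfl⟩ := hk
    obtain ⟨h1, h2, h3⟩ := k.2
    refine ⟨?_, ?_⟩
    · rw [hIV, ENNReal.ofReal_lt_ofReal_iff hV0] at h3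
      exact h3.le
    · have h4 := measure_mono (μ := volume) (hI.uIcc_subset k₀.2.1 h1)
      rw [Real.volume_interval, hIV, ENNReal.ofReal_le_ofReal_iff hV0.le] at h4
      exact h4
  have hsum : ∑ k ∈ s, carlesonWeight β g z k = ∑ k ∈ K, carlesonWeight β g z k := by
    rw [hK, Finset.sum_map]; rfl
  rw [hsum, hIV, ← ENNReal.ofReal_mul (by positivity)]
  -- The bound for finite products passes to the limit termwise. Convergence holds in `[0,∞]` even
  -- where the Blaschke product vanishes, because the numerators are finite.
  have hlim : Filter.Tendsto (fun n => ∑ k ∈ K,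
      ENNReal.ofReal ((2 * (z k).re / ‖shiftedWeight β g z k‖) ^ 2) /
        ENNReal.ofReal (‖finiteBlaschke (Finset.range n) z k‖ ^ 2)) Filter.atTop
      (nhds (∑ k ∈ K, carlesonWeight β g z k)) := by
    refine tendsto_finsetSum _ fun k _ => ?_
    rw [carlesonWeight_eq hg hz]
    refine ENNReal.Tendsto.const_div ?_ (Or.inr ENNReal.ofReal_ne_top)
    exact ENNReal.tendsto_ofReal ((tendsto_norm_finiteBlaschke hz k).pow 2)
  refine le_of_tendsto hlim ?_
  obtain ⟨N, hN⟩ := K.exists_nat_subset_range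
  filter_upwards [Filter.eventually_ge_atTop N] with n hn
  have hKn : K ⊆ Finset.range n := hN.trans (Finset.range_mono hn)
  refine le_trans (le_of_eq ?_) (ENNReal.ofReal_le_ofReal
    (sum_le_of_interpolation h hG hz hM.le hV0 hKmem hKn))
  rw [ENNReal.ofReal_sum_of_nonneg fun _ _ => sq_nonneg _]
  refine Finset.sum_congr rfl fun k hk => ?_
  have hB := norm_pos_iff.2 (finiteBlaschke_ne_zero hz
    ((injective_of_interpolation h hG).injOn) (hKn hk))
  rw [div_pow _ ‖finiteBlaschke _ _ _‖, ENNReal.ofReal_div_of_pos (by positivity)]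

theorem mainTheorem4 (β : ℝ) (hβ : 0 < β) (g z : ℕ → ℂ) (hg : ∀ k, g k ≠ 0)
    (hz : IsBlaschkeSequence z) :
    interpConst β g z < ∞ ↔
      ∃ κ : ℝ≥0, 0 < κ ∧ ∀ I : Set ℝ, I.OrdConnected →
        ∑' k : {k : ℕ // z k ∈ carlesonSquare I}, carlesonWeight β g z k ≤ κ * volume I := by
  have hz' := hz.1
  constructor
  · intro hfin
    -- Adding `1` makes the bound strict, so each infimum has an actual competitor below `m`.
    set m := (interpConst β g z).toReal + 1 with hm
    have hm0 : 0 < m := by positivity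
    have hlt : interpConst β g z < ENNReal.ofReal m := by
      rw [← ENNReal.ofReal_toReal hfin.ne]
      exact (ENNReal.ofReal_lt_ofReal_iff hm0).2 (lt_add_one _)
    refine ⟨Real.toNNReal (3 * (2 ^ β * m) ^ 2), Real.toNNReal_pos.2 (by positivity), ?_⟩
    refine carleson_of_interpolation hg hz' (by positivity) fun a ha => ?_
    have h1 : (⨅ (f : SobolevHalf β) (_ : ∀ k, g k * laplaceTransform f.1 (z k) = a k),
        ENNReal.ofReal (sobolevNorm f)) < ENNReal.ofReal m :=
      (le_iSup₂ (f := fun (a : lp (fun _ : ℕ => ℂ) 2) (_ : ‖a‖ = 1) =>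
        ⨅ (f : SobolevHalf β) (_ : ∀ k, g k * laplaceTransform f.1 (z k) = a k),
          ENNReal.ofReal (sobolevNorm f)) a ha).trans_lt hlt
    obtain ⟨f, h2⟩ := iInf_lt_iff.1 h1
    obtain ⟨hf, h3⟩ := iInf_lt_iff.1 h2
    obtain ⟨h, hn, hL⟩ := exists_laplaceTransform_eq_of_sobolev hβ f
    refine ⟨h, hn.trans ?_, fun k => ?_⟩
    · have := ((ENNReal.ofReal_lt_ofReal_iff hm0).1 h3).le
      gcongr
    · rw [← hf k, hL _ (hz' k), shiftedWeight, mul_assoc]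
  · rintro ⟨κ, hκ, hC⟩
    obtain ⟨M, hM⟩ := exists_interpolant_of_carleson hg hz' hκ hC
    refine lt_of_le_of_lt (b := ENNReal.ofReal (Real.sqrt 2 * M)) ?_ ENNReal.ofReal_lt_top
    refine iSup₂_le fun a ha => ?_
    obtain ⟨F, hF, hFk⟩ := hM a ha
    obtain ⟨f, hf, hL⟩ := exists_sobolev_laplaceTransform_eq hβ F
    refine iInf₂_le_of_le f (fun k => ?_) (ENNReal.ofReal_le_ofReal (hf.trans ?_))
    · rw [hL _ (hz' k), ← hFk k, shiftedWeight, mul_assoc]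
    · gcongr

end
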